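/- Let $N\ge 1$, let $\Omega\subset\mathbb R^N$ be a bounded domain (non-empty, open, connected) with $C^\infty$ boundary, let $1<p<\infty$, and let $\mathcal H^{N-1}$ denote the $(N-1)$-dimensional Hausdorff (surface) measure on $\partial\Omega$. For $f\in L^{p/(p-1)}(\partial\Omega)$ let $u_f\in W^{1,p}(\Omega)$ be the unique weak solution of $$-\Delta_p u+|u|^{p-2}u=0\ \text{ in }\Omega,\qquad |\nabla u|^{p-2}\frac{\partial u}{\partial\nu}=f\ \text{ on }\partial\Omega,$$ that is, $\int_\Omega |\nabla u_f|^{p-2}\nabla u_f\cdot\nabla v+|u_f|^{p-2}u_f v\,dx=\int_{\partial\Omega} f v\,d\mathcal H^{N-1}$ for all $v\in W^{1,p}(\Omega)$, where boundary values of Sobolev functions are understood as traces. Put $\mathcal J(f)=\int_{\partial\Omega} f u_f\,d\mathcal H^{N-1}$. Let $f_0\in L^{p/(p-1)}(\partial\Omega)$ and let $\mathcal R_{f_0}$ be the class of rearrangements of $f_0$, i.e. of the measurable functions on $\partial\Omega$ that have the same distribution as $f_0$ with respect to $\mathcal H^{N-1}$. Let $\hat f\in\mathcal R_{f_0}$ satisfy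 $\mathcal J(\hat f)=\sup_{f\in\mathcal R_{f_0}}\mathcal J(f)$, and let $\hat u=u_{\hat f}$. Then $\hat f$ is the unique (up to equality $\mathcal H^{N-1}$-a.e.) maximizer over $\mathcal R_{f_0}$ of the linear functional $L(f)=\int_{\partial\Omega} f\hat u\,d\mathcal H^{N-1}$. Consequently there are an interval $I\subset\mathbb R$ with $\hat u\in I$ $\mathcal H^{N-1}$-a.e. on $\partial\Omega$ and an increasing (i.e. non-decreasing) function $\varphi:I\to\mathbb R$ such that $\hat f=\varphi\circ\hat u$ $\mathcal H^{N-1}$-a.e. on $\partial\Omega$. -/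

import Mathlib

open MeasureTheory Filter Topology
open scoped ContDiff

noncomputable section

/-- Euclidean space `ℝ^N`. -/
abbrev Euc (N : ℕ) : Type := EuclideanSpace ℝ (Fin N)

/-- A bounded domain (non-empty connected open set) with smooth boundary: near each boundary point,
in suitable orthonormal coordinates with last axis `ν`, the set is the part of a ball that lies
strictly above the graph of a smooth function `γ` of the remaining coordinates (which are encoded by
the orthogonal projection `y - ⟪ν, y⟫ ν` of the point to the hyperplane `ν^⊥`). -/
structure IsSmoothBoundedDomain {N : ℕ} (Ω : Set (Euc N)) : Prop where
  isOpen : IsOpen Ω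
  isConnected : IsConnected Ω
  isBounded : Bornology.IsBounded Ω
  smooth_boundary : ∀ x ∈ frontier Ω, ∃ (r : ℝ) (ν : Euc N) (γ : Euc N → ℝ),
    0 < r ∧ ‖ν‖ = 1 ∧ ContDiff ℝ ∞ γ ∧
      ∀ y ∈ Metric.ball x r, (y ∈ Ω ↔ γ (y - inner ℝ ν y • ν) < inner ℝ ν y)

/-- The surface measure of `∂Ω`: the (normalised) `(N-1)`-dimensional Hausdorff measure,
restricted to `∂Ω`. -/
def surfaceMeasure {N : ℕ} (Ω : Set (Euc N)) : Measure (Euc N) :=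
  (μHE[N - 1] : Measure (Euc N)).restrict (frontier Ω)

/-- `G` is the weak (distributional) gradient of `u` in `Ω`. -/
def HasWeakGradient {N : ℕ} (Ω : Set (Euc N)) (u : Euc N → ℝ) (G : Euc N → Euc N) : Prop :=
  ∀ φ : Euc N → ℝ, ContDiff ℝ ∞ φ → HasCompactSupport φ → tsupport φ ⊆ Ω →
    ∫ x in Ω, u x • gradient φ x = - ∫ x in Ω, φ x • G x

/-- `u ∈ W^{1,p}(Ω)`, with weak gradient `G`. -/
structure MemSobolev {N : ℕ} (p : ℝ) (Ω : Set (Euc N)) (u : Euc N → ℝ) (G : Euc N → Euc N) :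
    Prop where
  memLp : MemLp u (ENNReal.ofReal p) (volume.restrict Ω)
  memLp_grad : MemLp G (ENNReal.ofReal p) (volume.restrict Ω)
  hasWeakGradient : HasWeakGradient Ω u G

/-- `w ∈ L^p(∂Ω)` is the trace on `∂Ω` of `u ∈ W^{1,p}(Ω)`: the trace operator is the extension by
continuity of the restriction to `∂Ω` from functions that are smooth up to the boundary. -/
def IsTrace {N : ℕ} (p : ℝ) (Ω : Set (Euc N)) (u w : Euc N → ℝ) : Prop :=
  MemLp w (ENNReal.ofReal p) (surfaceMeasure Ω) ∧
  ∃ G : Euc N → Euc N, MemSobolev p Ω u G ∧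
    ∃ φ : ℕ → Euc N → ℝ, (∀ n, ContDiff ℝ ∞ (φ n)) ∧
      Tendsto (fun n => eLpNorm (fun x => φ n x - u x) (ENNReal.ofReal p) (volume.restrict Ω))
        atTop (𝓝 0) ∧
      Tendsto (fun n => eLpNorm (fun x => gradient (φ n) x - G x) (ENNReal.ofReal p)
        (volume.restrict Ω)) atTop (𝓝 0) ∧
      Tendsto (fun n => eLpNorm (fun x => φ n x - w x) (ENNReal.ofReal p) (surfaceMeasure Ω))
        atTop (𝓝 0)

open Classical in
/-- The trace on `∂Ω` of `u ∈ W^{1,p}(Ω)` (determined a.e. with respect to surface measure). -/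
def boundaryTrace {N : ℕ} (p : ℝ) (Ω : Set (Euc N)) (u : Euc N → ℝ) : Euc N → ℝ :=
  if h : ∃ w, IsTrace p Ω u w then h.choose else 0

/-- `u ∈ W^{1,p}(Ω)` (a function with a trace on `∂Ω`) is a weak solution of
`-Δ_p u + |u|^{p-2} u = 0` in `Ω`, `|∇u|^{p-2} ∂u/∂ν = f` on `∂Ω`: for all `v ∈ W^{1,p}(Ω)`,
with trace `z` on `∂Ω`,
`∫_Ω |∇u|^{p-2} ∇u·∇v + |u|^{p-2} u v = ∫_{∂Ω} f z`. -/
def IsWeakSolution {N : ℕ} (p : ℝ) (Ω : Set (Euc N)) (f u : Euc N → ℝ) : Prop :=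
  ∃ Gu : Euc N → Euc N, MemSobolev p Ω u Gu ∧ (∃ w, IsTrace p Ω u w) ∧
    ∀ (v : Euc N → ℝ) (Gv : Euc N → Euc N) (z : Euc N → ℝ),
      MemSobolev p Ω v Gv → IsTrace p Ω v z →
        ∫ x in Ω, (‖Gu x‖ ^ (p - 2) * inner ℝ (Gu x) (Gv x) + |u x| ^ (p - 2) * u x * v x) =
          ∫ x, f x * z x ∂(surfaceMeasure Ω)

open Classical in
/-- The weak solution `u_f` of the Neumann problem with boundary flux `f` (determined a.e.). -/
def neumannSolution {N : ℕ} (p : ℝ) (Ω : Set (Euc N)) (f : Euc N → ℝ) : Euc N → ℝ :=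
  if h : ∃ u, IsWeakSolution p Ω f u then h.choose else 0

/-- The functional `J(f) = ∫_{∂Ω} f u_f`. -/
def functionalJ {N : ℕ} (p : ℝ) (Ω : Set (Euc N)) (f : Euc N → ℝ) : ℝ :=
  ∫ x, f x * boundaryTrace p Ω (neumannSolution p Ω f) x ∂(surfaceMeasure Ω)

/-- The linear functional `L(f) = ∫_{∂Ω} f u`, for a function `u ∈ W^{1,p}(Ω)`. -/
def functionalL {N : ℕ} (p : ℝ) (Ω : Set (Euc N)) (u f : Euc N → ℝ) : ℝ :=
  ∫ x, f x * boundaryTrace p Ω u x ∂(surfaceMeasure Ω)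

/-- The class of rearrangements of `f₀`: the functions on `∂Ω` with the same distribution as `f₀`
with respect to surface measure. -/
def rearrangements {N : ℕ} (Ω : Set (Euc N)) (f₀ : Euc N → ℝ) : Set (Euc N → ℝ) :=
  {f | ProbabilityTheory.IdentDistrib f f₀ (surfaceMeasure Ω) (surfaceMeasure Ω)}

end

/-! Testing the weak equation with the solution itself gives `J(f) = ∫ |u_f|^p + |∇u_f|^p`.
Convexity of `‖·‖^p` is the tangent inequality `‖a‖^p ≥ ‖b‖^p + p ‖b‖^(p-2) ⟨b, a - b⟩`. Take `a`
from `(u_f, ∇u_f)` and `b` from `(u_g, ∇u_g)`, integrate, and use the equation of `u_g` tested with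
`u_f`: this gives `p ∫ g u_f ≤ J(f) + (p-1) J(g)` (`functionalL_le_functionalJ`). If `f` maximizes
`J`, the right side is at most `p J(f) = p L(f)`, so `f` maximizes `L`. Equality forces `u_g = u_f`
and `∇u_g = ∇u_f` by strict convexity; the two equations then have the same left side, so `f` and
`g` agree against all smooth functions.

Monotonicity follows from uniqueness alone. If `f` were large on a non-null part of `{w ≤ c}` and
small on a non-null part of `{c ≤ w}`, with `w` the trace of `u_f`, exchanging its values there
would give a different rearrangement with no smaller `L` (`measure_eq_zero_or_of_unique_maximizer`).
With this excluded, `φ(c)` can be the essential supremum of `f` on `{w ≤ c}`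
(`exists_monotoneOn_comp_of_measure_eq_zero_or`).

As `neumannSolution` is a choice with default value `0`, the existence of weak solutions is needed
(`exists_isWeakSolution`). It comes from minimizing the energy over the closure of the triples `(φ,
∇φ, φ|_{∂Ω})`, where uniform convexity makes minimizing sequences Cauchy and `trace_inequality`
controls the boundary component. The trace inequality also shows that the surface measure is finite.
Uniqueness of solutions or of traces plays no role: the comparison holds for any choice of them. -/

/-! ### Pointwise convexity of the `p`-th power of a Hilbert norm. -/

section NormPow

variable {F : Type*} [NormedAddCommGroup F] [InnerProductSpace ℝ F]

theorem norm_rpow_sub_two_mul_inner_self {p : ℝ} (hp : 1 < p) (b : F) :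
    ‖b‖ ^ (p - 2) * inner ℝ b b = ‖b‖ ^ p := by
  rcases eq_or_ne b 0 with rfl | hb
  · simp [Real.zero_rpow (by linarith : p ≠ 0)]
  · rw [real_inner_self_eq_norm_sq, ← Real.rpow_natCast, ← Real.rpow_add (norm_pos_iff.2 hb)]
    congr 1
    push_cast
    ring

theorem abs_norm_rpow_sub_two_mul_inner_le (p : ℝ) (b c : F) :
    |‖b‖ ^ (p - 2) * inner ℝ b c| ≤ ‖b‖ ^ (p - 1) * ‖c‖ := by
  rcases eq_or_ne b 0 with rfl | hb
  · simp only [inner_zero_left, mul_zero, abs_zero]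
    positivity
  · rw [abs_mul, abs_of_nonneg (by positivity)]
    calc ‖b‖ ^ (p - 2) * |inner ℝ b c| ≤ ‖b‖ ^ (p - 2) * (‖b‖ * ‖c‖) := by
          gcongr
          exact abs_real_inner_le_norm b c
      _ = ‖b‖ ^ (p - 1) * ‖c‖ := by
          rw [← mul_assoc]
          congr 1
          nth_rewrite 2 [← Real.rpow_one ‖b‖]
          rw [← Real.rpow_add (norm_pos_iff.2 hb)]
          congr 1
          ring

/-- Young's inequality for `y` and `x ^ (p - 1)`, multiplied by `p`. -/
theorem rpow_sub_one_mul_le {p : ℝ} (hp : 1 < p) {x y : ℝ} (hx : 0 ≤ x) (hy : 0 ≤ y) :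
    p * (x ^ (p - 1) * y) ≤ (p - 1) * x ^ p + y ^ p := by
  have hq := Real.HolderConjugate.conjExponent hp
  have h := Real.young_inequality_of_nonneg hy (Real.rpow_nonneg hx (p - 1)) hq
  have h0 : p - 1 ≠ 0 := by linarith
  have h1 : (p - 1) * p.conjExponent = p := by
    rw [Real.conjExponent]
    field_simp
  rw [← Real.rpow_mul hx, h1, Real.conjExponent] at h
  have h2 := mul_le_mul_of_nonneg_left h (by linarith : (0 : ℝ) ≤ p)
  have h3 : p * (y ^ p / p + x ^ p / (p / (p - 1))) = (p - 1) * x ^ p + y ^ p := by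
    have : p ≠ 0 := by linarith
    field_simp
    ring
  linarith

/-- Cauchy–Schwarz bounds the pairing with `a` by `‖b‖ ^ (p - 1) * ‖a‖`, and Young's inequality does
the rest. -/
theorem norm_rpow_tangent_le {p : ℝ} (hp : 1 < p) (a b : F) :
    ‖b‖ ^ p + p * (‖b‖ ^ (p - 2) * inner ℝ b (a - b)) ≤ ‖a‖ ^ p := by
  have h1 := abs_norm_rpow_sub_two_mul_inner_le p b a
  have h2 := rpow_sub_one_mul_le hp (norm_nonneg b) (norm_nonneg a)
  have h3 := norm_rpow_sub_two_mul_inner_self hp b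
  rw [inner_sub_right, mul_sub, h3]
  have h4 := (le_abs_self _).trans h1
  nlinarith

theorem abs_norm_rpow_sub_two_mul_inner_le_add {p : ℝ} (hp : 1 < p) (b c : F) :
    |‖b‖ ^ (p - 2) * inner ℝ b c| ≤ ‖b‖ ^ p + ‖c‖ ^ p := by
  refine (abs_norm_rpow_sub_two_mul_inner_le p b c).trans ?_
  have h2 := rpow_sub_one_mul_le hp (norm_nonneg b) (norm_nonneg c)
  have h3 : 0 ≤ ‖b‖ ^ p := by positivity
  have h4 : 0 ≤ ‖c‖ ^ p := by positivity
  have h5 : 0 ≤ ‖b‖ ^ (p - 1) * ‖c‖ := by positivity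
  nlinarith

/-- For `p < 2` the factor `‖b‖ ^ (p - 2)` is singular at `0`; the product is nevertheless
continuous, being `1 / p` times the derivative of the `C^1` function `‖·‖ ^ p` in the direction `c`.
-/
theorem continuous_norm_rpow_sub_two_mul_inner {p : ℝ} (hp : 1 < p) (c : F) :
    Continuous fun b : F => ‖b‖ ^ (p - 2) * inner ℝ b c := by
  have h := ((contDiff_norm_rpow (E := F) hp).continuous_fderiv (by norm_num)).clm_apply
    (continuous_const (y := c))
  refine (h.const_smul p⁻¹).congr fun b => ?_
  have : p ≠ 0 := by linarith
  simp only [Pi.smul_apply, fderiv_norm_rpow b hp]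
  simp
  field_simp

theorem norm_midpoint_rpow_lt {p : ℝ} (hp : 1 < p) {a b : F} (hab : a ≠ b) :
    ‖(1 / 2 : ℝ) • (a + b)‖ ^ p < (‖a‖ ^ p + ‖b‖ ^ p) / 2 := by
  have hn : ‖(1 / 2 : ℝ) • (a + b)‖ = ‖a + b‖ / 2 := by
    rw [norm_smul]; norm_num; ring
  rw [hn]
  -- With equal norms strictness comes from the triangle inequality, an equality case there meaning
  -- the same ray; with different norms it comes from strict convexity of `t ^ p`.
  by_cases h : ‖a‖ = ‖b‖
  · have h1 : ‖a + b‖ < ‖a‖ + ‖b‖ := by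
      refine lt_of_le_of_ne (norm_add_le _ _) fun he => hab ?_
      exact (sameRay_iff_norm_add.2 he).eq_of_norm_eq h
    rw [← h] at h1 ⊢
    rw [show (‖a‖ ^ p + ‖a‖ ^ p) / 2 = ‖a‖ ^ p by ring]
    exact Real.rpow_lt_rpow (by positivity) (by linarith) (by linarith)
  · have h1 := (strictConvexOn_rpow hp).2 (norm_nonneg a) (norm_nonneg b) h
      (by norm_num : (0 : ℝ) < 1 / 2) (by norm_num : (0 : ℝ) < 1 / 2) (by norm_num)
    simp only [smul_eq_mul] at h1
    calc (‖a + b‖ / 2) ^ p ≤ (1 / 2 * ‖a‖ + 1 / 2 * ‖b‖) ^ p := by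
          refine Real.rpow_le_rpow (by positivity) ?_ (by linarith)
          linarith [norm_add_le a b]
      _ < _ := by linarith

theorem norm_midpoint_rpow_le {F : Type*} [NormedAddCommGroup F] [NormedSpace ℝ F] {p : ℝ}
    (hp : 1 < p) (a b : F) :
    ‖(1 / 2 : ℝ) • (a + b)‖ ^ p ≤ (‖a‖ ^ p + ‖b‖ ^ p) / 2 := by
  have hhalf : ‖(1 / 2 : ℝ) • (a + b)‖ ≤ (1 / 2) * ‖a‖ + (1 / 2) * ‖b‖ := by
    rw [norm_smul]
    have := norm_add_le a b
    norm_num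
    linarith
  have hconv := (convexOn_rpow hp.le).2 (norm_nonneg a) (norm_nonneg b)
    (by norm_num : (0 : ℝ) ≤ 1 / 2) (by norm_num : (0 : ℝ) ≤ 1 / 2) (by norm_num)
  simp only [smul_eq_mul] at hconv
  have := Real.rpow_le_rpow (norm_nonneg _) hhalf (by linarith : 0 ≤ p)
  linarith

/-- If the tangent at `b` touches at `a ≠ b`, the tangent inequality at the midpoint contradicts
strict midpoint convexity. -/
theorem eq_of_norm_rpow_tangent_eq {p : ℝ} (hp : 1 < p) {a b : F}
    (h : ‖b‖ ^ p + p * (‖b‖ ^ (p - 2) * inner ℝ b (a - b)) = ‖a‖ ^ p) : a = b := by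
  by_contra hab
  have h1 := norm_midpoint_rpow_lt hp hab
  have h2 := norm_rpow_tangent_le hp ((1 / 2 : ℝ) • (a + b)) b
  have h3 : (1 / 2 : ℝ) • (a + b) - b = (1 / 2 : ℝ) • (a - b) := by module
  rw [h3, inner_smul_right] at h2
  linarith

/-- Both sides are `p`-homogeneous, so it suffices to treat the unit sphere of `F × F`. Where `ε *
(‖a‖ ^ p + ‖b‖ ^ p)` alone does not suffice, the points form a compact set off the diagonal, and
there the midpoint defect has a positive minimum. This treats all `p > 1` at once. -/
theorem exists_norm_sub_rpow_le [FiniteDimensional ℝ F] {p : ℝ} (hp : 1 < p) {ε : ℝ}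
    (hε : 0 < ε) :
    ∃ C : ℝ, 0 ≤ C ∧ ∀ a b : F, ‖a - b‖ ^ p ≤ ε * (‖a‖ ^ p + ‖b‖ ^ p) +
      C * ((‖a‖ ^ p + ‖b‖ ^ p) / 2 - ‖(1 / 2 : ℝ) • (a + b)‖ ^ p) := by
  have hp0 : 0 < p := by linarith
  set d : F × F → ℝ := fun z =>
    (‖z.1‖ ^ p + ‖z.2‖ ^ p) / 2 - ‖(1 / 2 : ℝ) • (z.1 + z.2)‖ ^ p with hd
  have hdc : Continuous d := by
    have h : Continuous fun x : F => ‖x‖ ^ p := (contDiff_norm_rpow hp).continuous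
    exact (((h.comp continuous_fst).add (h.comp continuous_snd)).div_const 2).sub
      (h.comp ((continuous_fst.add continuous_snd).const_smul _))
  have hd0 : ∀ z, 0 ≤ d z := fun z => sub_nonneg.2 (norm_midpoint_rpow_le hp z.1 z.2)
  have key : ∃ C : ℝ, 0 ≤ C ∧ ∀ z ∈ Metric.sphere (0 : F × F) 1,
      ‖z.1 - z.2‖ ^ p ≤ ε * (‖z.1‖ ^ p + ‖z.2‖ ^ p) + C * d z := by
    set K : Set (F × F) := Metric.sphere 0 1 ∩
      {z | ε * (‖z.1‖ ^ p + ‖z.2‖ ^ p) ≤ ‖z.1 - z.2‖ ^ p} with hK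
    have hKc : IsCompact K := by
      refine (isCompact_sphere _ _).inter_right (isClosed_le ?_ ?_)
      · have h : Continuous fun x : F => ‖x‖ ^ p := (contDiff_norm_rpow hp).continuous
        exact ((h.comp continuous_fst).add (h.comp continuous_snd)).const_mul ε
      · have h : Continuous fun x : F => ‖x‖ ^ p := (contDiff_norm_rpow hp).continuous
        exact h.comp (continuous_fst.sub continuous_snd)
    rcases K.eq_empty_or_nonempty with hKe | hKn
    · refine ⟨0, le_rfl, fun z hz => ?_⟩
      by_contra hlt
      have : z ∈ K := ⟨hz, by simp only [Set.mem_ofPred_eq]; push Not at hlt; linarith⟩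
      rw [hKe] at this
      exact this
    · obtain ⟨z₀, hz₀, hmin⟩ := hKc.exists_isMinOn hKn hdc.continuousOn
      have hpos : 0 < d z₀ := by
        refine sub_pos.2 (norm_midpoint_rpow_lt hp fun heq => ?_)
        have h1 := hz₀.2
        simp only [Set.mem_ofPred_eq, heq, sub_self, norm_zero, Real.zero_rpow hp0.ne'] at h1
        have h2 : ‖z₀.2‖ ^ p = 0 := by
          have : 0 ≤ ‖z₀.2‖ ^ p := by positivity
          nlinarith
        have h3 : z₀.2 = 0 := by
          simpa using (Real.rpow_eq_zero (norm_nonneg _) hp0.ne').1 h2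
        have h4 : ‖z₀‖ = 1 := by simpa using hz₀.1
        have h5 : z₀ = 0 := Prod.ext (heq.trans h3) h3
        rw [h5] at h4
        simp at h4
      -- On the unit sphere of the sup norm `‖a - b‖ ≤ 2`, and the defect is at least `d z₀` on `K`.
      refine ⟨2 ^ p / d z₀, by positivity, fun z hz => ?_⟩
      by_cases hzK : ε * (‖z.1‖ ^ p + ‖z.2‖ ^ p) ≤ ‖z.1 - z.2‖ ^ p
      · have h1 : d z₀ ≤ d z := hmin ⟨hz, hzK⟩
        have hz1 : ‖z‖ = 1 := by simpa using hz
        have h2 : ‖z.1 - z.2‖ ≤ 2 := by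
          have := norm_fst_le z
          have := norm_snd_le z
          linarith [norm_sub_le z.1 z.2]
        have h3 : ‖z.1 - z.2‖ ^ p ≤ 2 ^ p := Real.rpow_le_rpow (norm_nonneg _) h2 hp0.le
        have h4 : (2 : ℝ) ^ p ≤ 2 ^ p / d z₀ * d z := by
          rw [div_mul_eq_mul_div, le_div_iff₀ hpos]
          gcongr
        have h5 : 0 ≤ ε * (‖z.1‖ ^ p + ‖z.2‖ ^ p) := by positivity
        linarith
      · have : 0 ≤ 2 ^ p / d z₀ * d z := mul_nonneg (by positivity) (hd0 z)
        push Not at hzK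
        linarith
  obtain ⟨C, hC, hkey⟩ := key
  refine ⟨C, hC, fun a b => ?_⟩
  set z : F × F := (a, b) with hz
  rcases eq_or_ne z 0 with h0 | h0
  · have ha : a = 0 := congrArg Prod.fst h0
    have hb : b = 0 := congrArg Prod.snd h0
    simp [ha, hb, Real.zero_rpow hp0.ne']
  · set r := ‖z‖ with hr
    have hrpos : 0 < r := norm_pos_iff.2 h0
    have h1 := hkey (r⁻¹ • z) (by
      rw [mem_sphere_zero_iff_norm, norm_smul, Real.norm_of_nonneg (by positivity), ← hr,
        inv_mul_cancel₀ hrpos.ne'])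
    have hs : ∀ x : F, ‖r⁻¹ • x‖ ^ p = (r⁻¹) ^ p * ‖x‖ ^ p := fun x => by
      rw [norm_smul, Real.norm_of_nonneg (by positivity),
        Real.mul_rpow (by positivity) (norm_nonneg _)]
    have e1 : (r⁻¹ • z).1 = r⁻¹ • a := rfl
    have e2 : (r⁻¹ • z).2 = r⁻¹ • b := rfl
    simp only [hd, e1, e2, ← smul_sub, ← smul_add, smul_comm (1 / 2 : ℝ) r⁻¹, hs] at h1
    have hpos : 0 < (r⁻¹) ^ p := by positivity
    refine le_of_mul_le_mul_left ?_ hpos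
    linarith

end NormPow

/-! ### Integrated forms of the convexity inequalities. -/

section IntegralPairing

variable {α : Type*} [MeasurableSpace α] {μ : Measure α}
variable {F : Type*} [NormedAddCommGroup F] [InnerProductSpace ℝ F]

theorem MeasureTheory.MemLp.integrable_norm_rpow_ofReal {F : Type*} [NormedAddCommGroup F] {p : ℝ} (hp : 1 < p) {f : α → F}
    (hf : MemLp f (ENNReal.ofReal p) μ) : Integrable (fun x => ‖f x‖ ^ p) μ := by
  have hp0 : 0 < p := by linarith
  have := hf.integrable_norm_rpow (by simpa using hp0) ENNReal.ofReal_ne_top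
  rwa [ENNReal.toReal_ofReal hp0.le] at this

theorem aestronglyMeasurable_norm_rpow_sub_two_mul_inner {p : ℝ} {f g : α → F}
    (hf : AEStronglyMeasurable f μ) (hg : AEStronglyMeasurable g μ) :
    AEStronglyMeasurable (fun x => ‖f x‖ ^ (p - 2) * inner ℝ (f x) (g x)) μ :=
  ((hf.norm.aemeasurable.pow_const (p - 2)).aestronglyMeasurable).mul (hf.inner hg)

theorem integrable_norm_rpow_sub_two_mul_inner {p : ℝ} (hp : 1 < p) {f g : α → F}
    (hf : MemLp f (ENNReal.ofReal p) μ) (hg : MemLp g (ENNReal.ofReal p) μ) :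
    Integrable (fun x => ‖f x‖ ^ (p - 2) * inner ℝ (f x) (g x)) μ := by
  refine Integrable.mono' ((hf.integrable_norm_rpow_ofReal hp).add
    (hg.integrable_norm_rpow_ofReal hp))
    (aestronglyMeasurable_norm_rpow_sub_two_mul_inner hf.1 hg.1) (ae_of_all _ fun x => ?_)
  exact abs_norm_rpow_sub_two_mul_inner_le_add hp (f x) (g x)

theorem integral_norm_rpow_tangent_le {p : ℝ} (hp : 1 < p) {f g : α → F}
    (hf : MemLp f (ENNReal.ofReal p) μ) (hg : MemLp g (ENNReal.ofReal p) μ) :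
    ∫ x, ‖g x‖ ^ p ∂μ + p * ∫ x, ‖g x‖ ^ (p - 2) * inner ℝ (g x) (f x - g x) ∂μ ≤
      ∫ x, ‖f x‖ ^ p ∂μ := by
  have h1 : Integrable (fun x => ‖g x‖ ^ (p - 2) * inner ℝ (g x) (f x - g x)) μ :=
    integrable_norm_rpow_sub_two_mul_inner hp hg (hf.sub hg)
  rw [← integral_const_mul, ← integral_add (hg.integrable_norm_rpow_ofReal hp) (h1.const_mul p)]
  exact integral_mono ((hg.integrable_norm_rpow_ofReal hp).add (h1.const_mul p))
    (hf.integrable_norm_rpow_ofReal hp) fun x => norm_rpow_tangent_le hp (f x) (g x)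

theorem ae_eq_of_integral_norm_rpow_tangent_eq {p : ℝ} (hp : 1 < p) {f g : α → F}
    (hf : MemLp f (ENNReal.ofReal p) μ) (hg : MemLp g (ENNReal.ofReal p) μ)
    (h : ∫ x, ‖f x‖ ^ p ∂μ ≤
      ∫ x, ‖g x‖ ^ p ∂μ + p * ∫ x, ‖g x‖ ^ (p - 2) * inner ℝ (g x) (f x - g x) ∂μ) :
    f =ᵐ[μ] g := by
  have h1 : Integrable (fun x => ‖g x‖ ^ (p - 2) * inner ℝ (g x) (f x - g x)) μ :=
    integrable_norm_rpow_sub_two_mul_inner hp hg (hf.sub hg)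
  have h2 := (hg.integrable_norm_rpow_ofReal hp).add (h1.const_mul p)
  have h3 := hf.integrable_norm_rpow_ofReal hp
  rw [← integral_const_mul,
    ← integral_add (hg.integrable_norm_rpow_ofReal hp) (h1.const_mul p)] at h
  have h4 : ∫ x, (‖f x‖ ^ p -
      (‖g x‖ ^ p + p * (‖g x‖ ^ (p - 2) * inner ℝ (g x) (f x - g x)))) ∂μ = 0 := by
    refine le_antisymm ?_ (integral_nonneg fun x =>
      sub_nonneg.2 (norm_rpow_tangent_le hp (f x) (g x)))
    have := integral_sub h3 h2
    simp only [Pi.add_apply] at this h ⊢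
    linarith
  rw [integral_eq_zero_iff_of_nonneg (fun x => sub_nonneg.2 (norm_rpow_tangent_le hp (f x) (g x)))
    (h3.sub h2)] at h4
  filter_upwards [h4] with x hx
  refine eq_of_norm_rpow_tangent_eq hp ?_
  simp only [Pi.zero_apply] at hx
  linarith

/-- The limit needed for the Euler–Lagrange equation, by dominated convergence with a majorant valid
for `0 < t < 1`. -/
theorem tendsto_integral_norm_rpow_sub_two_mul_inner {p : ℝ} (hp : 1 < p) {f g : α → F}
    (hf : MemLp f (ENNReal.ofReal p) μ) (hg : MemLp g (ENNReal.ofReal p) μ) :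
    Tendsto (fun t : ℝ => ∫ x, ‖f x + t • g x‖ ^ (p - 2) * inner ℝ (f x + t • g x) (g x) ∂μ)
      (𝓝[>] 0) (𝓝 (∫ x, ‖f x‖ ^ (p - 2) * inner ℝ (f x) (g x) ∂μ)) := by
  have hfg := (hf.norm.add hg.norm).integrable_norm_rpow_ofReal hp
  refine tendsto_integral_filter_of_dominated_convergence
    (fun x => ‖‖f x‖ + ‖g x‖‖ ^ p + ‖g x‖ ^ p) ?_ ?_
    (hfg.add (hg.integrable_norm_rpow_ofReal hp)) ?_
  · exact Eventually.of_forall fun t =>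
      aestronglyMeasurable_norm_rpow_sub_two_mul_inner (hf.1.add (hg.1.const_smul t)) hg.1
  · have : ∀ᶠ t in 𝓝[>] (0 : ℝ), t ∈ Set.Ioo (0 : ℝ) 1 := Ioo_mem_nhdsGT one_pos
    filter_upwards [this] with t ht
    refine ae_of_all _ fun x => (abs_norm_rpow_sub_two_mul_inner_le_add hp _ _).trans ?_
    gcongr
    rw [Real.norm_of_nonneg (by positivity)]
    refine (norm_add_le _ _).trans ?_
    rw [norm_smul, Real.norm_of_nonneg ht.1.le]
    have := norm_nonneg (g x)
    nlinarith [ht.2]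
  · refine ae_of_all _ fun x => ?_
    have h := (continuous_norm_rpow_sub_two_mul_inner hp (g x)).comp
      (show Continuous fun t : ℝ => f x + t • g x by fun_prop)
    have := h.tendsto 0
    simp only [Function.comp_def, zero_smul, add_zero] at this
    exact this.mono_left nhdsWithin_le_nhds

end IntegralPairing

/-! ### Exchange of values, and monotone dependence from unique maximality. -/

section Rearrangement

theorem continuous_cdf (ν : Measure ℝ) [IsProbabilityMeasure ν] [NullSingletonClass ν] :
    Continuous (ProbabilityTheory.cdf ν) := by
  refine continuous_iff_continuousAt.2 fun a => ?_
  have hm := (ProbabilityTheory.cdf ν).mono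
  rw [hm.continuousAt_iff_leftLim_eq_rightLim, (ProbabilityTheory.cdf ν).rightLim_eq]
  have h : (ProbabilityTheory.cdf ν).measure {a} = 0 := by
    rw [ProbabilityTheory.measure_cdf, measure_singleton]
  rw [StieltjesFunction.measure_singleton, ENNReal.ofReal_eq_zero] at h
  exact le_antisymm (hm.leftLim_le le_rfl) (by linarith)

/-- Probability integral transform: a continuous distribution function carries its own law to the
uniform one. -/
theorem measurable_and_map_cdf_eq_volume (ν : Measure ℝ) [IsProbabilityMeasure ν]
    [NullSingletonClass ν] :
    ∃ V : ℝ → unitInterval, Measurable V ∧ ν.map V = volume := by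
  set F := ProbabilityTheory.cdf ν with hF
  have hcont : Continuous F := continuous_cdf ν
  let V : ℝ → unitInterval := fun t =>
    ⟨F t, ProbabilityTheory.cdf_nonneg ν t, ProbabilityTheory.cdf_le_one ν t⟩
  have hV : Measurable V := (hcont.subtype_mk _).measurable
  refine ⟨V, hV, ?_⟩
  have := Measure.isProbabilityMeasure_map (μ := ν) hV.aemeasurable
  refine Measure.ext_of_Iic _ _ fun t => ?_
  rw [Measure.map_apply hV measurableSet_Iic, unitInterval.volume_Iic]
  rcases eq_or_ne t 1 with rfl | ht1
  · have : V ⁻¹' Set.Iic 1 = Set.univ := Set.eq_univ_of_forall fun s => unitInterval.le_one'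
    simp [this]
  have ht1' : (t : ℝ) < 1 := lt_of_le_of_ne t.2.2 fun h => ht1 (Subtype.ext h)
  have hpre : V ⁻¹' Set.Iic t = {s | F s ≤ t} := rfl
  rcases (V ⁻¹' Set.Iic t).eq_empty_or_nonempty with he | hne
  · rw [he, measure_empty]
    refine (ENNReal.ofReal_eq_zero.2 ?_).symm
    by_contra! hpos
    obtain ⟨s, hs⟩ := ((ProbabilityTheory.tendsto_cdf_atBot ν).eventually
      (gt_mem_nhds hpos)).exists
    have : s ∈ V ⁻¹' Set.Iic t := le_of_lt hs
    rw [he] at this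
    exact this
  · have hbdd : BddAbove (V ⁻¹' Set.Iic t) := by
      obtain ⟨s, hs⟩ := ((ProbabilityTheory.tendsto_cdf_atTop ν).eventually
        (lt_mem_nhds ht1')).exists
      refine ⟨s, fun r hr => ?_⟩
      by_contra! hlt
      have h1 : F s ≤ F r := F.mono hlt.le
      have h2 : F r ≤ t := hr
      linarith
    have hclosed : IsClosed (V ⁻¹' Set.Iic t) := by
      rw [hpre]
      exact isClosed_le hcont continuous_const
    set s₀ := sSup (V ⁻¹' Set.Iic t) with hs₀
    have hmem : F s₀ ≤ t := hclosed.csSup_mem hne hbdd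
    have heq : V ⁻¹' Set.Iic t = Set.Iic s₀ := by
      ext s
      exact ⟨fun hs => le_csSup hbdd hs, fun hs => (F.mono hs).trans hmem⟩
    -- Were `F s₀ < t`, continuity would keep `F < t` slightly to the right of `s₀`, against
    -- maximality of `s₀`.
    have hval : F s₀ = t := by
      refine le_antisymm hmem ?_
      by_contra! hlt
      have hev : ∀ᶠ s in 𝓝[>] s₀, F s < t :=
        ((hcont.tendsto s₀).eventually (gt_mem_nhds hlt)).filter_mono nhdsWithin_le_nhds
      obtain ⟨s, hs, hs'⟩ := (hev.and self_mem_nhdsWithin).exists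
      have : s ∈ V ⁻¹' Set.Iic t := le_of_lt hs
      rw [heq] at this
      exact absurd hs' (not_lt.2 this)
    rw [heq, ← ProbabilityTheory.ofReal_cdf, ← hF, hval]

theorem exists_measurable_map_eq_volume_unitInterval {X : Type*} [MeasurableSpace X]
    [StandardBorelSpace X] (μ : Measure X) [IsProbabilityMeasure μ] [NullSingletonClass μ] :
    ∃ U : X → unitInterval, Measurable U ∧ μ.map U = volume := by
  obtain ⟨e, he⟩ := exists_measurableEmbedding_real X
  have := Measure.isProbabilityMeasure_map (μ := μ) he.measurable.aemeasurable
  have : NullSingletonClass (μ.map e) := ⟨fun t => by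
    rw [he.map_apply]
    exact (Set.subsingleton_singleton.preimage he.injective).measure_zero μ⟩
  obtain ⟨V, hV, hmap⟩ := measurable_and_map_cdf_eq_volume (μ.map e)
  exact ⟨V ∘ e, hV.comp he.measurable, by rw [← Measure.map_map hV he.measurable, hmap]⟩

variable {X : Type*} [MeasurableSpace X]

theorem isProbabilityMeasure_inv_smul_restrict {σ : Measure X} [IsFiniteMeasure σ] {A : Set X}
    (hA : σ A ≠ 0) : IsProbabilityMeasure ((σ A)⁻¹ • σ.restrict A) :=
  ⟨by simp [ENNReal.inv_mul_cancel hA (measure_ne_top σ A)]⟩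

/-- An atomless measure takes all intermediate values: carry the normalised measure on `A` to `[0,
1]` and pull back the initial interval of length `c / σ A`. -/
theorem exists_measurable_subset_measure_eq [StandardBorelSpace X] {σ : Measure X}
    [IsFiniteMeasure σ] [NullSingletonClass σ] {A : Set X} (hA : MeasurableSet A)
    {c : ENNReal} (hc : c ≤ σ A) : ∃ A' ⊆ A, MeasurableSet A' ∧ σ A' = c := by
  rcases eq_or_ne (σ A) 0 with h0 | h0
  · exact ⟨∅, Set.empty_subset _, MeasurableSet.empty, by
      rw [measure_empty]; exact (le_antisymm (hc.trans h0.le) bot_le).symm⟩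
  have := isProbabilityMeasure_inv_smul_restrict (σ := σ) h0
  have : NullSingletonClass ((σ A)⁻¹ • σ.restrict A) := ⟨fun x => by simp⟩
  obtain ⟨U, hU, hmap⟩ := exists_measurable_map_eq_volume_unitInterval ((σ A)⁻¹ • σ.restrict A)
  have hfin := measure_ne_top σ A
  have hcfin : c ≠ ⊤ := ne_top_of_le_ne_top hfin hc
  set t : ℝ := (c / σ A).toReal with ht
  have hle : c / σ A ≤ 1 := ENNReal.div_le_of_le_mul (by simpa using hc)
  have ht1 : t ≤ 1 := by
    have := ENNReal.toReal_mono ENNReal.one_ne_top hle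
    rwa [ENNReal.toReal_one] at this
  let T : unitInterval := ⟨t, ENNReal.toReal_nonneg, ht1⟩
  have h1 := congrArg (fun m => m (Set.Iic T)) hmap
  simp only [Measure.map_apply hU measurableSet_Iic, unitInterval.volume_Iic, Measure.smul_apply,
    smul_eq_mul, Measure.restrict_apply (hU measurableSet_Iic)] at h1
  refine ⟨U ⁻¹' Set.Iic T ∩ A, Set.inter_subset_right, (hU measurableSet_Iic).inter hA, ?_⟩
  have h2 : ENNReal.ofReal (T : ℝ) = c / σ A :=
    ENNReal.ofReal_toReal (ne_top_of_le_ne_top ENNReal.one_ne_top hle)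
  rw [h2, ENNReal.div_eq_inv_mul] at h1
  exact (ENNReal.mul_right_inj (ENNReal.inv_ne_zero.2 hfin) (ENNReal.inv_ne_top.2 h0)).1 h1

/-- Both laws pass through the uniform one: `U` makes `A` uniform, and a quantile function `q`
produces the law of `f` on `B`. -/
theorem exists_measurable_map_restrict_eq [StandardBorelSpace X] {σ : Measure X}
    [IsFiniteMeasure σ] [NullSingletonClass σ] {A B : Set X} (hAB : σ A = σ B) (hA0 : σ A ≠ 0)
    {f : X → ℝ} (hf : Measurable f) :
    ∃ h : X → ℝ, Measurable h ∧ (σ.restrict A).map h = (σ.restrict B).map f := by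
  have hB0 : σ B ≠ 0 := hAB ▸ hA0
  have := isProbabilityMeasure_inv_smul_restrict (σ := σ) hA0
  have := isProbabilityMeasure_inv_smul_restrict (σ := σ) hB0
  have : NullSingletonClass ((σ A)⁻¹ • σ.restrict A) := ⟨fun x => by simp⟩
  obtain ⟨U, hU, hUmap⟩ := exists_measurable_map_eq_volume_unitInterval ((σ A)⁻¹ • σ.restrict A)
  have := Measure.isProbabilityMeasure_map (μ := (σ B)⁻¹ • σ.restrict B) hf.aemeasurable
  obtain ⟨q, hq, hqmap⟩ := Measure.exists_measurable_map_eq (((σ B)⁻¹ • σ.restrict B).map f)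
  refine ⟨q ∘ U, hq.comp hU, ?_⟩
  have h1 : ((σ A)⁻¹ • σ.restrict A).map (q ∘ U) = ((σ B)⁻¹ • σ.restrict B).map f := by
    rw [← Measure.map_map hq hU, hUmap]
    exact hqmap
  rw [Measure.map_smul, Measure.map_smul, hAB] at h1
  have h2 := congrArg (fun m => σ B • m) h1
  simpa [smul_smul, ENNReal.mul_inv_cancel hB0 (measure_ne_top σ B)] using h2

/-- Any two sets of positive measure contain parts of equal positive measure whose values under any
function can be exchanged without changing their distribution. -/
def AdmitsExchange (σ : Measure X) : Prop :=
  ∀ A B : Set X, MeasurableSet A → MeasurableSet B → σ A ≠ 0 → σ B ≠ 0 →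
    ∃ A' ⊆ A, ∃ B' ⊆ B, MeasurableSet A' ∧ MeasurableSet B' ∧ σ A' ≠ 0 ∧
      ∀ f : X → ℝ, Measurable f → ∃ h k : X → ℝ, Measurable h ∧ Measurable k ∧
        (σ.restrict A').map h = (σ.restrict B').map f ∧
        (σ.restrict B').map k = (σ.restrict A').map f

theorem admitsExchange_of_nullSingletonClass [StandardBorelSpace X] (σ : Measure X)
    [IsFiniteMeasure σ] [NullSingletonClass σ] : AdmitsExchange σ := by
  intro A B hA hB hA0 hB0
  obtain ⟨A', hA'A, hA'm, hA'⟩ := exists_measurable_subset_measure_eq hA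
    (min_le_left (σ A) (σ B))
  obtain ⟨B', hB'B, hB'm, hB'⟩ := exists_measurable_subset_measure_eq hB
    (min_le_right (σ A) (σ B))
  have hpos : min (σ A) (σ B) ≠ 0 := by
    rcases min_choice (σ A) (σ B) with h | h <;> rw [h] <;> assumption
  refine ⟨A', hA'A, B', hB'B, hA'm, hB'm, hA' ▸ hpos, fun f hf => ?_⟩
  obtain ⟨h, hh, hmap⟩ := exists_measurable_map_restrict_eq (hA'.trans hB'.symm) (hA' ▸ hpos) hf
  obtain ⟨k, hk, kmap⟩ := exists_measurable_map_restrict_eq (hB'.trans hA'.symm) (hB' ▸ hpos) hf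
  exact ⟨h, k, hh, hk, hmap, kmap⟩

/-- The case `N = 1`, where boundary points are atoms of equal mass and single points can be
swapped. -/
theorem admitsExchange_of_atoms [MeasurableSingletonClass X] {σ : Measure X} {m : ENNReal}
    (hm : m ≠ 0) {S : Set X} (hS : σ Sᶜ = 0) (hatom : ∀ x ∈ S, σ {x} = m) :
    AdmitsExchange σ := by
  have hmem : ∀ A : Set X, σ A ≠ 0 → ∃ a ∈ A, a ∈ S := by
    intro A hA0
    by_contra! h
    exact hA0 (measure_mono_null (fun a ha => h a ha) hS)
  have hmap : ∀ a ∈ S, ∀ f : X → ℝ, Measurable f →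
      (σ.restrict {a}).map f = m • Measure.dirac (f a) := fun a ha f hf => by
    rw [Measure.restrict_singleton, Measure.map_smul, Measure.map_dirac' hf, hatom a ha]
  intro A B hA hB hA0 hB0
  obtain ⟨a, haA, haS⟩ := hmem A hA0
  obtain ⟨b, hbB, hbS⟩ := hmem B hB0
  refine ⟨{a}, by simpa using haA, {b}, by simpa using hbB, measurableSet_singleton a,
    measurableSet_singleton b, by rw [hatom a haS]; exact hm, fun f hf =>
      ⟨fun _ => f b, fun _ => f a, measurable_const, measurable_const, ?_, ?_⟩⟩
  · rw [hmap a haS _ measurable_const, hmap b hbS f hf]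
  · rw [hmap b hbS _ measurable_const, hmap a haS f hf]

theorem map_piecewise_exchange {σ : Measure X} {A B : Set X} (hA : MeasurableSet A)
    (hB : MeasurableSet B) (hdisj : Disjoint A B) {f h k : X → ℝ} (hf : Measurable f)
    (hmap : (σ.restrict A).map h = (σ.restrict B).map f)
    (kmap : (σ.restrict B).map k = (σ.restrict A).map f)
    {g : X → ℝ} (hg : Measurable g) (hgA : ∀ x ∈ A, g x = h x) (hgB : ∀ x ∈ B, g x = k x)
    (hgc : ∀ x, x ∉ A → x ∉ B → g x = f x) : σ.map g = σ.map f := by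
  have hdecomp : σ = σ.restrict A + σ.restrict B + σ.restrict (A ∪ B)ᶜ := by
    rw [← Measure.restrict_union hdisj hB, Measure.restrict_add_restrict_compl (hA.union hB)]
  have e1 : (σ.restrict A).map g = (σ.restrict A).map h :=
    Measure.map_congr ((ae_restrict_iff' hA).2 (ae_of_all _ hgA))
  have e2 : (σ.restrict B).map g = (σ.restrict B).map k :=
    Measure.map_congr ((ae_restrict_iff' hB).2 (ae_of_all _ hgB))
  have e3 : (σ.restrict (A ∪ B)ᶜ).map g = (σ.restrict (A ∪ B)ᶜ).map f :=
    Measure.map_congr ((ae_restrict_iff' (hA.union hB).compl).2 (ae_of_all _ fun x hx =>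
      hgc x (fun h => hx (Or.inl h)) (fun h => hx (Or.inr h))))
  rw [hdecomp, Measure.map_add _ _ hg, Measure.map_add _ _ hg, Measure.map_add _ _ hf,
    Measure.map_add _ _ hf, e1, e2, e3, hmap, kmap, add_comm ((σ.restrict B).map f)]

/-- If both sets had positive measure, exchange values between parts `A` and `B` of them to get `g`.
Then `(g - f) * (w - c) ≥ 0` a.e., while `∫ (g - f) = 0` by equal distribution; so `∫ g w ≥ ∫ f w`
and hence `g = f` a.e. But `g ≤ s' < s ≤ f` a.e. on `A`. -/
theorem measure_eq_zero_or_of_unique_maximizer {σ : Measure X} [IsFiniteMeasure σ]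
    (hex : AdmitsExchange σ) {f w : X → ℝ} (hf : Measurable f) (hw : Measurable w)
    (hfi : Integrable f σ)
    (hint : ∀ g, ProbabilityTheory.IdentDistrib g f σ σ → Integrable (fun x => g x * w x) σ)
    (hmax : ∀ g, ProbabilityTheory.IdentDistrib g f σ σ →
      ∫ x, f x * w x ∂σ ≤ ∫ x, g x * w x ∂σ → g =ᵐ[σ] f)
    {c s s' : ℝ} (hs : s' < s) :
    σ {x | w x ≤ c ∧ s ≤ f x} = 0 ∨ σ {x | c ≤ w x ∧ f x ≤ s'} = 0 := by
  classical
  by_contra! hcon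
  obtain ⟨hA0, hB0⟩ := hcon
  have hAm : MeasurableSet {x | w x ≤ c ∧ s ≤ f x} :=
    (measurableSet_le hw measurable_const).inter (measurableSet_le measurable_const hf)
  have hBm : MeasurableSet {x | c ≤ w x ∧ f x ≤ s'} :=
    (measurableSet_le measurable_const hw).inter (measurableSet_le hf measurable_const)
  obtain ⟨A, hAA, B, hBB, hA, hB, hApos, hswap⟩ := hex _ _ hAm hBm hA0 hB0
  obtain ⟨h, k, hh, hk, hmap, kmap⟩ := hswap f hf
  have hdisj : Disjoint A B := Set.disjoint_left.2 fun x hxA hxB => by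
    have h1 := (hAA hxA).2
    have h2 := (hBB hxB).2
    linarith
  set g : X → ℝ := A.piecewise h (B.piecewise k f) with hg
  have hgm : Measurable g := hh.piecewise hA (hk.piecewise hB hf)
  have hgA : ∀ x ∈ A, g x = h x := fun x hx => Set.piecewise_eq_of_mem _ _ _ hx
  have hgB : ∀ x ∈ B, g x = k x := fun x hx => by
    rw [hg, Set.piecewise_eq_of_notMem _ _ _ (Set.disjoint_right.1 hdisj hx),
      Set.piecewise_eq_of_mem _ _ _ hx]
  have hgc : ∀ x, x ∉ A → x ∉ B → g x = f x := fun x hxA hxB => by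
    rw [hg, Set.piecewise_eq_of_notMem _ _ _ hxA, Set.piecewise_eq_of_notMem _ _ _ hxB]
  have hid : ProbabilityTheory.IdentDistrib g f σ σ :=
    ⟨hgm.aemeasurable, hf.aemeasurable,
      map_piecewise_exchange hA hB hdisj hf hmap kmap hgm hgA hgB hgc⟩
  -- Bounds on values pass between the two sets because they depend only on the laws.
  have hle : ∀ᵐ x ∂σ, x ∈ A → h x ≤ s' := by
    rw [← ae_restrict_iff' hA]
    have : ∀ᵐ y ∂((σ.restrict A).map h), y ≤ s' := by
      rw [hmap, ae_map_iff hf.aemeasurable measurableSet_Iic, ae_restrict_iff' hB]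
      exact ae_of_all _ fun x hx => (hBB hx).2
    exact ae_of_ae_map hh.aemeasurable this
  have hge : ∀ᵐ x ∂σ, x ∈ B → s ≤ k x := by
    rw [← ae_restrict_iff' hB]
    have : ∀ᵐ y ∂((σ.restrict B).map k), s ≤ y := by
      rw [kmap, ae_map_iff hf.aemeasurable measurableSet_Ici, ae_restrict_iff' hA]
      exact ae_of_all _ fun x hx => (hAA hx).2
    exact ae_of_ae_map hk.aemeasurable this
  have hgi : Integrable g σ := hid.symm.integrable_snd hfi
  have hnonneg : 0 ≤ ∫ x, ((g x * w x - f x * w x) - c * (g x - f x)) ∂σ := by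
    refine integral_nonneg_of_ae ?_
    filter_upwards [hle, hge] with x hx1 hx2
    simp only [Pi.zero_apply]
    by_cases hxA : x ∈ A
    · have h1 := hAA hxA
      have h2 := hx1 hxA
      rw [hgA x hxA]
      nlinarith [h1.1, h1.2, mul_nonneg (sub_nonneg.2 h1.1)
        (by linarith [h1.2] : (0 : ℝ) ≤ f x - h x)]
    · by_cases hxB : x ∈ B
      · have h1 := hBB hxB
        have h2 := hx2 hxB
        rw [hgB x hxB]
        nlinarith [h1.1, h1.2, mul_nonneg (sub_nonneg.2 h1.1)
          (by linarith [h1.2] : (0 : ℝ) ≤ k x - f x)]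
      · rw [hgc x hxA hxB]
        simp
  have hfid := ProbabilityTheory.IdentDistrib.refl hf.aemeasurable (μ := σ)
  have hi1 : Integrable (fun x => g x * w x - f x * w x) σ := (hint g hid).sub (hint f hfid)
  have hi2 : Integrable (fun x => c * (g x - f x)) σ := (hgi.sub hfi).const_mul c
  rw [integral_sub hi1 hi2, integral_sub (hint g hid) (hint f hfid), integral_const_mul,
    integral_sub hgi hfi, hid.integral_eq, sub_self, mul_zero, sub_zero] at hnonneg
  have heq := hmax g hid (by linarith)
  refine hApos (measure_eq_zero_iff_ae_notMem.2 ?_)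
  filter_upwards [heq, hle] with x hx1 hx2 hxA
  have h1 := (hAA hxA).2
  have h2 := hx2 hxA
  rw [hgA x hxA] at hx1
  linarith

/-- Lets an uncountable union of null sets `{w ≤ c}`, `c ∈ D`, be replaced by a countable one. A
countable dense subset containing a greatest element of `D`, if there is one, is cofinal. -/
theorem exists_countable_cofinal (D : Set ℝ) :
    ∃ t ⊆ D, t.Countable ∧ ∀ d ∈ D, ∃ e ∈ t, d ≤ e := by
  obtain ⟨s, hsc, hsd, -, hst⟩ := exists_countable_dense_bot_top D
  refine ⟨Subtype.val '' s, by simp, hsc.image _, fun d hd => ?_⟩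
  by_cases htop : IsTop (⟨d, hd⟩ : D)
  · exact ⟨d, ⟨⟨d, hd⟩, hst _ htop, rfl⟩, le_rfl⟩
  · simp only [IsTop, not_forall, not_le] at htop
    obtain ⟨e, he⟩ := htop
    obtain ⟨e', he', he's⟩ := hsd.exists_mem_open isOpen_Ioi ⟨e, he⟩
    exact ⟨e', ⟨e', he', rfl⟩, le_of_lt he's⟩

theorem exists_countable_coinitial (D : Set ℝ) :
    ∃ t ⊆ D, t.Countable ∧ ∀ d ∈ D, ∃ e ∈ t, e ≤ d := by
  obtain ⟨s, hsc, hsd, hsb, -⟩ := exists_countable_dense_bot_top D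
  refine ⟨Subtype.val '' s, by simp, hsc.image _, fun d hd => ?_⟩
  by_cases hbot : IsBot (⟨d, hd⟩ : D)
  · exact ⟨d, ⟨⟨d, hd⟩, hsb _ hbot, rfl⟩, le_rfl⟩
  · simp only [IsBot, not_forall, not_le] at hbot
    obtain ⟨e, he⟩ := hbot
    obtain ⟨e', he', he's⟩ := hsd.exists_mem_open isOpen_Iio ⟨e, he⟩
    exact ⟨e', ⟨e', he', rfl⟩, le_of_lt he's⟩

theorem ae_of_forall_measure_le_eq_zero {σ : Measure X} {w : X → ℝ} {P : X → Prop} (D : Set ℝ)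
    (h : ∀ c ∈ D, σ {x | w x ≤ c ∧ P x} = 0) : ∀ᵐ x ∂σ, w x ∈ D → ¬ P x := by
  obtain ⟨t, htD, htc, ht⟩ := exists_countable_cofinal D
  have hae : ∀ᵐ x ∂σ, ∀ c ∈ t, ¬ (w x ≤ c ∧ P x) :=
    (ae_ball_iff htc).2 fun c hc => measure_eq_zero_iff_ae_notMem.1 (h c (htD hc))
  filter_upwards [hae] with x hx hxD hP
  obtain ⟨e, he, hle⟩ := ht _ hxD
  exact hx e he ⟨hle, hP⟩

theorem ae_of_forall_measure_ge_eq_zero {σ : Measure X} {w : X → ℝ} {P : X → Prop} (D : Set ℝ)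
    (h : ∀ c ∈ D, σ {x | c ≤ w x ∧ P x} = 0) : ∀ᵐ x ∂σ, w x ∈ D → ¬ P x := by
  obtain ⟨t, htD, htc, ht⟩ := exists_countable_coinitial D
  have hae : ∀ᵐ x ∂σ, ∀ c ∈ t, ¬ (c ≤ w x ∧ P x) :=
    (ae_ball_iff htc).2 fun c hc => measure_eq_zero_iff_ae_notMem.1 (h c (htD hc))
  filter_upwards [hae] with x hx hxD hP
  obtain ⟨e, he, hle⟩ := ht _ hxD
  exact hx e he ⟨hle, hP⟩

theorem exists_ge_of_measure_ne_zero {σ : Measure X} {f : X → ℝ} {Q : X → Prop}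
    (h : σ {x | Q x} ≠ 0) : ∃ s : ℝ, σ {x | Q x ∧ s ≤ f x} ≠ 0 := by
  by_contra! hcon
  refine h (measure_mono_null (t := ⋃ n : ℕ, {x | Q x ∧ (-(n : ℝ)) ≤ f x}) (fun x hx => ?_)
    (measure_iUnion_null fun n => hcon _))
  obtain ⟨n, hn⟩ := exists_nat_ge (-f x)
  exact Set.mem_iUnion.2 ⟨n, hx, by linarith⟩

theorem exists_le_of_measure_ne_zero {σ : Measure X} {f : X → ℝ} {Q : X → Prop}
    (h : σ {x | Q x} ≠ 0) : ∃ s : ℝ, σ {x | Q x ∧ f x ≤ s} ≠ 0 := by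
  by_contra! hcon
  refine h (measure_mono_null (t := ⋃ n : ℕ, {x | Q x ∧ f x ≤ n}) (fun x hx => ?_)
    (measure_iUnion_null fun n => hcon _))
  obtain ⟨n, hn⟩ := exists_nat_ge (f x)
  exact Set.mem_iUnion.2 ⟨n, hx, hn⟩

theorem exists_monotoneOn_comp_of_measure_eq_zero_or {σ : Measure X} {f w : X → ℝ}
    (h : ∀ c s s' : ℝ, s' < s →
      σ {x | w x ≤ c ∧ s ≤ f x} = 0 ∨ σ {x | c ≤ w x ∧ f x ≤ s'} = 0) :
    ∃ (I : Set ℝ) (φ : ℝ → ℝ), I.OrdConnected ∧ MonotoneOn φ I ∧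
      ∀ᵐ x ∂σ, w x ∈ I ∧ f x = φ (w x) := by
  set I : Set ℝ := {c | σ {x | w x ≤ c} ≠ 0 ∧ σ {x | c ≤ w x} ≠ 0} with hI
  -- `sSup (S c)` is the essential supremum of `f` on `{w ≤ c}`. On `I` it is finite: since `{c ≤
  -- w}` is not null, `f ≤ s'` on a non-null part of it for some `s'`, and the hypothesis then
  -- bounds `S c` by `s'`.
  set S : ℝ → Set ℝ := fun c => {s | σ {x | w x ≤ c ∧ s ≤ f x} ≠ 0} with hS
  have hne : ∀ c ∈ I, (S c).Nonempty := fun c hc => exists_ge_of_measure_ne_zero hc.1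
  have hbdd : ∀ c ∈ I, BddAbove (S c) := by
    intro c hc
    obtain ⟨s', hs'⟩ := exists_le_of_measure_ne_zero (f := f) hc.2
    refine ⟨s', fun s hs => ?_⟩
    by_contra! hlt
    exact (h c s s' hlt).elim hs hs'
  have hwI : ∀ᵐ x ∂σ, w x ∈ I := by
    have h1 := ae_of_forall_measure_le_eq_zero (σ := σ) (w := w) (P := fun _ => True)
      {c | σ {x | w x ≤ c} = 0} (fun c hc => by simpa using hc)
    have h2 := ae_of_forall_measure_ge_eq_zero (σ := σ) (w := w) (P := fun _ => True)
      {c | σ {x | c ≤ w x} = 0} (fun c hc => by simpa using hc)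
    filter_upwards [h1, h2] with x hx1 hx2
    exact ⟨fun hx => hx1 hx trivial, fun hx => hx2 hx trivial⟩
  have hconn : ∀ a ∈ I, ∀ b ∈ I, Set.Icc a b ⊆ I := by
    refine fun a ha b hb c hc => ⟨fun h0 => ha.1 ?_, fun h0 => hb.2 ?_⟩
    · exact measure_mono_null (fun x hx => le_trans hx hc.1) h0
    · exact measure_mono_null (fun x hx => le_trans hc.2 hx) h0
  refine ⟨I, (fun c => sSup (S c)), Set.ordConnected_def.2 (fun a ha b hb => hconn a ha b hb),
    fun a ha b hb hab => ?_, ?_⟩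
  · refine csSup_le_csSup (hbdd b hb) (hne a ha) fun s hs h0 => hs ?_
    exact measure_mono_null (fun x (hx : w x ≤ a ∧ s ≤ f x) =>
      (⟨hx.1.trans hab, hx.2⟩ : w x ≤ b ∧ s ≤ f x)) h0
  · have hup : ∀ᵐ x ∂σ, ∀ q : ℚ, w x ∈ {c | c ∈ I ∧ sSup (S c) < q} → ¬ (q : ℝ) ≤ f x := by
      refine ae_all_iff.2 fun q => ae_of_forall_measure_le_eq_zero _ fun c hc => ?_
      by_contra h0
      exact absurd (le_csSup (hbdd c hc.1) h0) (not_le.2 hc.2)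
    -- If `q < sSup (S c)`, some `s > q` makes `{w ≤ c, s ≤ f}` non-null, so the dichotomy makes `{c
    -- ≤ w, f ≤ q}` null.
    have hlow : ∀ᵐ x ∂σ, ∀ q : ℚ, w x ∈ {c | c ∈ I ∧ (q : ℝ) < sSup (S c)} → ¬ f x ≤ q := by
      refine ae_all_iff.2 fun q => ae_of_forall_measure_ge_eq_zero _ fun c hc => ?_
      obtain ⟨s, hs, hqs⟩ := exists_lt_of_lt_csSup (hne c hc.1) hc.2
      exact (h c s q hqs).resolve_left hs
    filter_upwards [hwI, hup, hlow] with x hxI hx1 hx2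
    refine ⟨hxI, le_antisymm ?_ ?_⟩
    · by_contra! hlt
      obtain ⟨q, hq1, hq2⟩ := exists_rat_btwn hlt
      exact hx1 q ⟨hxI, hq1⟩ hq2.le
    · by_contra! hlt
      obtain ⟨q, hq1, hq2⟩ := exists_rat_btwn hlt
      exact hx2 q ⟨hxI, hq2⟩ hq1.le

theorem exists_monotoneOn_comp_of_unique_maximizer {σ : Measure X} [IsFiniteMeasure σ]
    (hex : AdmitsExchange σ) {f w : X → ℝ} (hf : AEMeasurable f σ) (hw : AEMeasurable w σ)
    (hfi : Integrable f σ)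
    (hint : ∀ g, ProbabilityTheory.IdentDistrib g f σ σ → Integrable (fun x => g x * w x) σ)
    (hmax : ∀ g, ProbabilityTheory.IdentDistrib g f σ σ →
      ∫ x, f x * w x ∂σ ≤ ∫ x, g x * w x ∂σ → g =ᵐ[σ] f) :
    ∃ (I : Set ℝ) (φ : ℝ → ℝ), I.OrdConnected ∧ MonotoneOn φ I ∧
      ∀ᵐ x ∂σ, w x ∈ I ∧ f x = φ (w x) := by
  have hff := hf.ae_eq_mk
  have hww := hw.ae_eq_mk
  have hid : ProbabilityTheory.IdentDistrib (hf.mk f) f σ σ :=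
    (ProbabilityTheory.IdentDistrib.of_ae_eq hf hff).symm
  have hcongr : ∀ g : X → ℝ, (fun x => g x * w x) =ᵐ[σ] fun x => g x * hw.mk w x := fun g => by
    filter_upwards [hww] with x hx
    rw [hx]
  obtain ⟨I, φ, hI, hφ, hae⟩ := exists_monotoneOn_comp_of_measure_eq_zero_or (σ := σ)
    (f := hf.mk f) (w := hw.mk w) fun c s s' hs =>
      measure_eq_zero_or_of_unique_maximizer hex hf.measurable_mk hw.measurable_mk
        (hfi.congr hff) (fun g hg => (hint g (hg.trans hid)).congr (hcongr g))
        (fun g hg hle => (hmax g (hg.trans hid) (by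
          rw [integral_congr_ae (hcongr g), integral_congr_ae (hcongr f)]
          refine le_trans (le_of_eq (integral_congr_ae ?_)) hle
          filter_upwards [hff] with x hx
          rw [hx])).trans hff) hs
  refine ⟨I, φ, hI, hφ, ?_⟩
  filter_upwards [hae, hff, hww] with x hx h1 h2
  rw [h1, h2]
  exact hx

end Rearrangement

/-! ### Bounding an endpoint value by an integral along a segment. -/

section OneDimensional

theorem lintegral_rpow_le_measure_rpow_mul {α : Type*} [MeasurableSpace α] {μ : Measure α}
    {p : ℝ} (hp : 1 < p) {f : α → ℝ} (hf : AEStronglyMeasurable f μ) :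
    (∫⁻ x, ‖f x‖ₑ ∂μ) ^ p ≤ μ Set.univ ^ (p - 1) * ∫⁻ x, ‖f x‖ₑ ^ p ∂μ := by
  have hp0 : 0 < p := by linarith
  have h := eLpNorm_le_eLpNorm_mul_rpow_measure_univ (μ := μ) (f := f) (p := 1)
    (q := ENNReal.ofReal p) (by simpa using hp.le) hf
  rw [eLpNorm_one_eq_lintegral_enorm, eLpNorm_eq_lintegral_rpow_enorm_toReal (by simpa using hp0)
    ENNReal.ofReal_ne_top, ENNReal.toReal_ofReal hp0.le] at h
  have h2 := ENNReal.rpow_le_rpow h hp0.le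
  rw [ENNReal.mul_rpow_of_nonneg _ _ hp0.le, ← ENNReal.rpow_mul, ← ENNReal.rpow_mul] at h2
  have e1 : 1 / p * p = 1 := by field_simp
  have e2 : (1 / (1 : ENNReal).toReal - 1 / p) * p = p - 1 := by
    simp only [ENNReal.toReal_one]
    field_simp
  rw [e1, e2, ENNReal.rpow_one, mul_comm] at h2
  exact h2

/-- Write `ψ 0` as `ψ s` minus an integral of `ψ'`, take `p`-th powers (whence `2 ^ (p - 1)`),
average over `s ∈ (0, h)` and apply Hölder to the integral of `|ψ'|`. -/
theorem enorm_apply_zero_rpow_le {p : ℝ} (hp : 1 < p) {h : ℝ} (hh : 0 < h) {ψ : ℝ → ℝ}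
    (hψ : ContDiff ℝ 1 ψ) :
    ‖ψ 0‖ₑ ^ p ≤ ENNReal.ofReal h⁻¹ * 2 ^ (p - 1) * (1 + ENNReal.ofReal h ^ p) *
      ∫⁻ t in Set.Ioo 0 h, (‖ψ t‖ₑ ^ p + ‖deriv ψ t‖ₑ ^ p) := by
  have hp0 : 0 < p := by linarith
  have hcd : Continuous (deriv ψ) := hψ.continuous_deriv le_rfl
  set D := ∫⁻ t in Set.Ioo 0 h, ‖deriv ψ t‖ₑ with hD
  set A := ∫⁻ t in Set.Ioo 0 h, ‖ψ t‖ₑ ^ p with hA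
  set B := ∫⁻ t in Set.Ioo 0 h, ‖deriv ψ t‖ₑ ^ p with hB
  have hvol : (volume.restrict (Set.Ioo 0 h)) Set.univ = ENNReal.ofReal h := by simp
  have hDB : D ^ p ≤ ENNReal.ofReal h ^ (p - 1) * B := by
    have := lintegral_rpow_le_measure_rpow_mul (μ := volume.restrict (Set.Ioo 0 h)) hp
      hcd.aestronglyMeasurable
    rwa [hvol] at this
  have hpt : ∀ s ∈ Set.Ioo 0 h, ‖ψ 0‖ₑ ≤ ‖ψ s‖ₑ + D := by
    intro s hs
    have hftc : ∫ t in (0 : ℝ)..s, deriv ψ t = ψ s - ψ 0 :=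
      intervalIntegral.integral_deriv_eq_sub (fun t _ => (hψ.differentiable (by norm_num)) t)
        (hcd.intervalIntegrable _ _)
    have h1 : ‖ψ s - ψ 0‖ₑ ≤ D := by
      rw [← hftc, intervalIntegral.integral_of_le hs.1.le]
      refine (enorm_integral_le_lintegral_enorm _).trans (lintegral_mono_set fun t ht => ?_)
      exact ⟨ht.1, lt_of_le_of_lt ht.2 hs.2⟩
    calc ‖ψ 0‖ₑ = ‖ψ s - (ψ s - ψ 0)‖ₑ := by rw [sub_sub_cancel]
      _ ≤ ‖ψ s‖ₑ + ‖ψ s - ψ 0‖ₑ := enorm_sub_le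
      _ ≤ ‖ψ s‖ₑ + D := by gcongr
  have hpt2 : ∀ s ∈ Set.Ioo 0 h, ‖ψ 0‖ₑ ^ p ≤ 2 ^ (p - 1) * (‖ψ s‖ₑ ^ p + D ^ p) := fun s hs =>
    (ENNReal.rpow_le_rpow (hpt s hs) hp0.le).trans (ENNReal.rpow_add_le_mul_rpow_add_rpow _ _ hp.le)
  have hint : ENNReal.ofReal h * ‖ψ 0‖ₑ ^ p ≤ 2 ^ (p - 1) * (A + ENNReal.ofReal h * D ^ p) := by
    have h1 : ∫⁻ _ in Set.Ioo 0 h, ‖ψ 0‖ₑ ^ p ≤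
        ∫⁻ s in Set.Ioo 0 h, 2 ^ (p - 1) * (‖ψ s‖ₑ ^ p + D ^ p) :=
      setLIntegral_mono' measurableSet_Ioo hpt2
    have hmeas : Measurable fun s => ‖ψ s‖ₑ ^ p := by
      have := hψ.continuous
      fun_prop
    rw [lintegral_const, hvol, lintegral_const_mul' _ _ (by finiteness), lintegral_add_left hmeas,
      lintegral_const, hvol] at h1
    rwa [mul_comm, mul_comm (ENNReal.ofReal h)]
  have hsum : ∫⁻ t in Set.Ioo 0 h, (‖ψ t‖ₑ ^ p + ‖deriv ψ t‖ₑ ^ p) = A + B := by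
    have hmeas : Measurable fun s => ‖ψ s‖ₑ ^ p := by
      have := hψ.continuous
      fun_prop
    exact lintegral_add_left hmeas _
  rw [hsum]
  have hpow : ENNReal.ofReal h * ENNReal.ofReal h ^ (p - 1) = ENNReal.ofReal h ^ p := by
    nth_rewrite 1 [← ENNReal.rpow_one (ENNReal.ofReal h)]
    rw [← ENNReal.rpow_add _ _ (by simpa using hh) ENNReal.ofReal_ne_top]
    congr 1
    ring
  have hinv : ENNReal.ofReal h⁻¹ * ENNReal.ofReal h = 1 := by
    rw [← ENNReal.ofReal_mul (by positivity), inv_mul_cancel₀ hh.ne', ENNReal.ofReal_one]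
  calc ‖ψ 0‖ₑ ^ p = ENNReal.ofReal h⁻¹ * (ENNReal.ofReal h * ‖ψ 0‖ₑ ^ p) := by
        rw [← mul_assoc, hinv, one_mul]
    _ ≤ ENNReal.ofReal h⁻¹ * (2 ^ (p - 1) * (A + ENNReal.ofReal h *
          (ENNReal.ofReal h ^ (p - 1) * B))) := by
        refine mul_le_mul_right (hint.trans ?_) _
        gcongr
    _ = ENNReal.ofReal h⁻¹ * 2 ^ (p - 1) * (A + ENNReal.ofReal h ^ p * B) := by
        rw [← mul_assoc (ENNReal.ofReal h), hpow, ← mul_assoc]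
    _ ≤ ENNReal.ofReal h⁻¹ * 2 ^ (p - 1) * ((1 + ENNReal.ofReal h ^ p) * (A + B)) := by
        gcongr
        rw [add_mul, one_mul]
        gcongr
        · exact le_self_add
        · exact le_add_self
    _ = _ := by rw [← mul_assoc]

theorem enorm_rpow_le_lintegral_along {E : Type*} [NormedAddCommGroup E] [InnerProductSpace ℝ E]
    [CompleteSpace E] {p : ℝ} (hp : 1 < p) {h : ℝ} (hh : 0 < h) {φ : E → ℝ}
    (hφ : ContDiff ℝ ∞ φ) {ν : E} (hν : ‖ν‖ = 1) (y : E) :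
    ‖φ y‖ₑ ^ p ≤ ENNReal.ofReal h⁻¹ * 2 ^ (p - 1) * (1 + ENNReal.ofReal h ^ p) *
      ∫⁻ t in Set.Ioo 0 h, (‖φ (y + t • ν)‖ₑ ^ p + ‖gradient φ (y + t • ν)‖ₑ ^ p) := by
  have hψ : ContDiff ℝ 1 fun t : ℝ => φ (y + t • ν) := by
    have : ContDiff ℝ 1 φ := hφ.of_le (by norm_cast)
    fun_prop
  have h1 := enorm_apply_zero_rpow_le hp hh hψ
  simp only [zero_smul, add_zero] at h1
  refine h1.trans ?_
  gcongr with t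
  have hd : HasGradientAt φ (gradient φ (y + t • ν)) (y + t • ν) :=
    ((hφ.differentiable (by simp)) _).hasGradientAt
  have hl : HasDerivAt (fun t : ℝ => y + t • ν) ν t := by
    simpa using ((hasDerivAt_id t).smul_const ν).const_add y
  have hc := hd.hasFDerivAt.comp_hasDerivAt t hl
  have he : deriv (fun t : ℝ => φ (y + t • ν)) t = inner ℝ (gradient φ (y + t • ν)) ν := by
    simpa [Function.comp_def] using hc.deriv
  rw [he, ← ofReal_norm, ← ofReal_norm]
  refine ENNReal.ofReal_le_ofReal ?_
  have := norm_inner_le_norm (𝕜 := ℝ) (gradient φ (y + t • ν)) ν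
  rwa [hν, mul_one] at this

end OneDimensional

/-! ### The boundary as a Lipschitz graph, and the trace inequality. -/

section Geometry

/-- Fubini in the coordinates `ν^⊥ ⊕ ℝ ν`. -/
theorem lintegral_eq_lintegral_orthogonal {E : Type*} [NormedAddCommGroup E]
    [InnerProductSpace ℝ E] [FiniteDimensional ℝ E] [MeasurableSpace E] [BorelSpace E]
    {ν : E} (hν : ‖ν‖ = 1) {F : E → ENNReal} (hF : Measurable F) :
    ∫⁻ x, F x = ∫⁻ v : (Submodule.span ℝ {ν})ᗮ, ∫⁻ t : ℝ, F (v + t • ν) := by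
  set s := Submodule.span ℝ {ν} with hs
  have h1 := (s.measurePreserving_measurableEquivProd (0 : E)).symm
  rw [InnerProductSpace.euclideanHausdorffMeasure_eq_volume] at h1
  have h0 : ∫⁻ q : s × sᗮ, F ((s.measurableEquivProd (0 : E)).symm q) =
      ∫⁻ v : sᗮ, ∫⁻ x : s, F ((s.measurableEquivProd (0 : E)).symm (x, v)) :=
    lintegral_prod_symm' _ (hF.comp h1.measurable)
  rw [← h1.lintegral_comp hF, h0]
  refine lintegral_congr fun v => ?_
  have h2 := (LinearIsometryEquiv.toSpanUnitSingleton (𝕜 := ℝ) ν hν).measurePreserving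
  have hm : Measurable fun x : s => F ((s.measurableEquivProd (0 : E)).symm (x, v)) :=
    (hF.comp h1.measurable).comp (by fun_prop)
  rw [← h2.lintegral_comp hm]
  refine lintegral_congr fun t => ?_
  simp [add_comm]

variable {N : ℕ}

theorem frontier_graph {Ω : Set (Euc N)} (hΩ : IsOpen Ω) {x ν : Euc N} {r : ℝ} {γ : Euc N → ℝ}
    (hγ : Continuous γ)
    (h : ∀ y ∈ Metric.ball x r, (y ∈ Ω ↔ γ (y - inner ℝ ν y • ν) < inner ℝ ν y)) :
    ∀ y ∈ frontier Ω ∩ Metric.ball x r, γ (y - inner ℝ ν y • ν) = inner ℝ ν y := by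
  rintro y ⟨hyf, hyb⟩
  have hy1 : y ∉ Ω := by
    rw [hΩ.frontier_eq] at hyf
    exact hyf.2
  refine le_antisymm ?_ (not_lt.1 fun hlt => hy1 ((h y hyb).2 hlt))
  have hcl : IsClosed {z : Euc N | γ (z - inner ℝ ν z • ν) ≤ inner ℝ ν z} :=
    isClosed_le (by fun_prop) (by fun_prop)
  have hmem : y ∈ closure (Ω ∩ Metric.ball x r) := by
    rw [Set.inter_comm]
    exact Metric.isOpen_ball.inter_closure ⟨hyb, frontier_subset_closure hyf⟩
  exact hcl.closure_subset_iff.2 (fun z hz => ((h z hz.2).1 hz.1).le) hmem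

theorem LipschitzOnWith.euclideanHausdorffMeasure_image_le {X Y : Type*} [EMetricSpace X]
    [EMetricSpace Y] [MeasurableSpace X] [BorelSpace X] [MeasurableSpace Y] [BorelSpace Y]
    {K : NNReal} {f : X → Y} {s : Set X} (h : LipschitzOnWith K f s) (d : ℕ) :
    μHE[d] (f '' s) ≤ (K : ENNReal) ^ (d : ℝ) * μHE[d] s := by
  simp only [Measure.euclideanHausdorffMeasure_def, Measure.smul_apply, ENNReal.smul_def,
    smul_eq_mul]
  rw [mul_left_comm]
  gcongr
  exact h.hausdorffMeasure_image_le d.cast_nonneg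

theorem finrank_orthogonal_span_unit {ν : Euc N} (hν : ‖ν‖ = 1) :
    Module.finrank ℝ (Submodule.span ℝ {ν})ᗮ = N - 1 := by
  have hν0 : ν ≠ 0 := fun h => by simp [h] at hν
  have h1 := (Submodule.span ℝ {ν}).finrank_add_finrank_orthogonal
  rw [finrank_span_singleton hν0, finrank_euclideanSpace_fin] at h1
  omega

/-- The part of the boundary measure on a set covered by a Lipschitz graph over the hyperplane
`ν^⊥` is controlled by Lebesgue measure on that hyperplane. -/
theorem lintegral_surface_le_lintegral_graph {ν : Euc N} (hν : ‖ν‖ = 1) {γ : Euc N → ℝ}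
    (hγ : Continuous γ) {S : Set (Euc N)}
    (hgraph : ∀ y ∈ S, γ (y - inner ℝ ν y • ν) = inner ℝ ν y) {K : NNReal} {T : Set (Euc N)}
    (hK : LipschitzOnWith K γ T) (hT : ∀ y ∈ S, y - inner ℝ ν y • ν ∈ T)
    {F : Euc N → ENNReal} (hF : Measurable F) :
    ∫⁻ y in S, F y ∂(μHE[N - 1] : Measure (Euc N)) ≤
      ((1 + K : NNReal) : ENNReal) ^ ((N - 1 : ℕ) : ℝ) *
      ∫⁻ v : (Submodule.span ℝ {ν})ᗮ in {v : (Submodule.span ℝ {ν})ᗮ | (v : Euc N) + γ v • ν ∈ S},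
        F (v + γ v • ν) := by
  set V := (Submodule.span ℝ {ν})ᗮ with hV
  set Φ : V → Euc N := fun v => (v : Euc N) + γ v • ν with hΦ
  set L : ENNReal := ((1 + K : NNReal) : ENNReal) ^ ((N - 1 : ℕ) : ℝ) with hL
  have hΦm : Measurable Φ := by
    have : Continuous Φ := by fun_prop
    exact this.measurable
  have horth : ∀ v : V, inner ℝ ν (v : Euc N) = 0 := fun v =>
    Submodule.mem_orthogonal_singleton_iff_inner_right.1 v.2
  have hinner : ∀ v : V, inner ℝ ν (Φ v) = γ v := fun v => by
    rw [hΦ, inner_add_right, horth, inner_smul_right, real_inner_self_eq_norm_sq, hν]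
    ring
  have hproj : ∀ v : V, Φ v - inner ℝ ν (Φ v) • ν = v := fun v => by
    rw [hinner, hΦ, add_sub_cancel_right]
  have hlip : LipschitzOnWith (1 + K) Φ (Φ ⁻¹' S) := by
    have h1 : LipschitzOnWith 1 (fun v : V => (v : Euc N)) (Φ ⁻¹' S) :=
      (LipschitzWith.subtype_val _).lipschitzOnWith
    refine h1.add ?_
    refine LipschitzOnWith.of_dist_le_mul fun v hv w hw => ?_
    have hvT : (v : Euc N) ∈ T := hproj v ▸ hT _ hv
    have hwT : (w : Euc N) ∈ T := hproj w ▸ hT _ hw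
    rw [dist_eq_norm, ← sub_smul, norm_smul, hν, mul_one, ← dist_eq_norm]
    exact hK.dist_le_mul _ hvT _ hwT
  have hmeas : (μHE[N - 1] : Measure (Euc N)).restrict S ≤
      L • (volume.restrict (Φ ⁻¹' S)).map Φ := by
    refine Measure.le_iff.2 fun A hA => ?_
    rw [Measure.restrict_apply hA, Measure.smul_apply, Measure.map_apply hΦm hA,
      Measure.restrict_apply (hΦm hA), smul_eq_mul, ← Set.preimage_inter]
    have hsub : A ∩ S ⊆ Φ '' (Φ ⁻¹' (A ∩ S)) := by
      intro y hy
      have hyV : y - inner ℝ ν y • ν ∈ V := by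
        rw [hV, Submodule.mem_orthogonal_singleton_iff_inner_right, inner_sub_right,
          inner_smul_right, real_inner_self_eq_norm_sq, hν]
        ring
      have hy2 : Φ ⟨_, hyV⟩ = y := by
        simp only [hΦ, hgraph y hy.2]
        abel
      exact ⟨⟨_, hyV⟩, by rw [Set.mem_preimage, hy2]; exact hy, hy2⟩
    refine (measure_mono hsub).trans ?_
    have h2 := (hlip.mono (Set.preimage_mono Set.inter_subset_right :
      Φ ⁻¹' (A ∩ S) ⊆ Φ ⁻¹' S)).euclideanHausdorffMeasure_image_le (N - 1)
    refine h2.trans (le_of_eq ?_)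
    have h3 : (μHE[N - 1] : Measure V) = volume := by
      rw [← finrank_orthogonal_span_unit hν]
      exact InnerProductSpace.euclideanHausdorffMeasure_eq_volume
    rw [h3]
  calc ∫⁻ y in S, F y ∂(μHE[N - 1] : Measure (Euc N))
      ≤ ∫⁻ y, F y ∂(L • (volume.restrict (Φ ⁻¹' S)).map Φ) := lintegral_mono' hmeas le_rfl
    _ = L * ∫⁻ v in Φ ⁻¹' S, F (Φ v) := by
        rw [lintegral_smul_measure, lintegral_map hF hΦm, smul_eq_mul]

/-- From each nearby boundary point the segment of length `h` in direction `ν` stays in `Ω`. The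
one-dimensional bound along it, integrated over the hyperplane `ν^⊥`, is by Fubini an integral over
`Ω`. -/
theorem trace_inequality_near {Ω : Set (Euc N)} (hΩ : IsSmoothBoundedDomain Ω) {p : ℝ}
    (hp : 1 < p) {x : Euc N} (hx : x ∈ frontier Ω) :
    ∃ ρ : ℝ, 0 < ρ ∧ ∃ C : ENNReal, C ≠ ⊤ ∧ ∀ φ : Euc N → ℝ, ContDiff ℝ ∞ φ →
      ∫⁻ y in Metric.ball x ρ, ‖φ y‖ₑ ^ p ∂(surfaceMeasure Ω) ≤
        C * ∫⁻ y in Ω, (‖φ y‖ₑ ^ p + ‖gradient φ y‖ₑ ^ p) := by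
  obtain ⟨r, ν, γ, hr, hν, hγ, hloc⟩ := hΩ.smooth_boundary x hx
  have hγc : Continuous γ := hγ.continuous
  -- `γ` is only locally Lipschitz, so the ball is shrunk until its projection lies in `T`.
  obtain ⟨K, T, hT, hK⟩ := (hγ.contDiffAt (x := x - inner ℝ ν x • ν)).of_le
    (by norm_cast) |>.exists_lipschitzOnWith
  have hproj : Continuous fun y : Euc N => y - inner ℝ ν y • ν := by fun_prop
  obtain ⟨ρ₁, hρ₁, hball⟩ := Metric.mem_nhds_iff.1 (hproj.continuousAt.preimage_mem_nhds hT)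
  -- Half the radius: a point within `h` of `x`, moved by less than `h`, remains in the chart ball.
  set h : ℝ := r / 2 with hh
  have hhpos : 0 < h := by positivity
  set ρ : ℝ := min ρ₁ h with hρ
  set S : Set (Euc N) := Metric.ball x ρ ∩ frontier Ω with hS
  have hSm : MeasurableSet S := measurableSet_ball.inter isClosed_frontier.measurableSet
  have hgraph : ∀ y ∈ S, γ (y - inner ℝ ν y • ν) = inner ℝ ν y := fun y hy =>
    frontier_graph hΩ.isOpen hγc hloc y ⟨hy.2, Metric.ball_subset_ball
      ((min_le_right _ _).trans (by linarith)) hy.1⟩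
  have hST : ∀ y ∈ S, y - inner ℝ ν y • ν ∈ T := fun y hy =>
    hball (Metric.ball_subset_ball (min_le_left _ _) hy.1)
  have hin : ∀ y ∈ S, ∀ t ∈ Set.Ioo 0 h, y + t • ν ∈ Ω := by
    intro y hy t ht
    have hnu : inner ℝ ν (y + t • ν) = inner ℝ ν y + t := by
      rw [inner_add_right, inner_smul_right, real_inner_self_eq_norm_sq, hν]
      ring
    have hb : y + t • ν ∈ Metric.ball x r := by
      have h1 : dist y x < h := lt_of_lt_of_le hy.1 (min_le_right _ _)
      have h2 : dist (y + t • ν) y < h := by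
        rw [dist_eq_norm, add_sub_cancel_left, norm_smul, hν, mul_one,
          Real.norm_of_nonneg ht.1.le]
        exact ht.2
      have h3 := dist_triangle (y + t • ν) y x
      rw [Metric.mem_ball]
      linarith
    rw [hloc _ hb, hnu]
    have e : y + t • ν - (inner ℝ ν y + t) • ν = y - inner ℝ ν y • ν := by module
    rw [e, hgraph y hy]
    linarith [ht.1]
  set C₁ : ENNReal := ENNReal.ofReal h⁻¹ * 2 ^ (p - 1) * (1 + ENNReal.ofReal h ^ p) with hC₁
  set L : ENNReal := ((1 + K : NNReal) : ENNReal) ^ ((N - 1 : ℕ) : ℝ) with hL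
  have hC₁top : C₁ ≠ ⊤ := by
    have : ENNReal.ofReal h ^ p ≠ ⊤ := ENNReal.rpow_ne_top_of_nonneg (by linarith)
      ENNReal.ofReal_ne_top
    have : (2 : ENNReal) ^ (p - 1) ≠ ⊤ := ENNReal.rpow_ne_top_of_nonneg (by linarith)
      (by finiteness)
    finiteness
  have hLtop : L ≠ ⊤ := ENNReal.rpow_ne_top_of_nonneg (Nat.cast_nonneg _) ENNReal.coe_ne_top
  refine ⟨ρ, lt_min hρ₁ hhpos, L * C₁, ENNReal.mul_ne_top hLtop hC₁top, fun φ hφ => ?_⟩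
  have hφc : Continuous φ := hφ.continuous
  have hgc : Continuous (gradient φ) :=
    ((InnerProductSpace.toDual ℝ (Euc N)).symm.continuous).comp
      (hφ.continuous_fderiv (by simp))
  set g : Euc N → ENNReal := fun y => ‖φ y‖ₑ ^ p + ‖gradient φ y‖ₑ ^ p with hg
  have hgm : Measurable g := by fun_prop
  have hFm : Measurable fun y => ‖φ y‖ₑ ^ p := by fun_prop
  have hIm : Measurable (Ω.indicator g) := hgm.indicator hΩ.isOpen.measurableSet
  rw [surfaceMeasure, Measure.restrict_restrict measurableSet_ball]
  refine (lintegral_surface_le_lintegral_graph hν hγc hgraph hK hST hFm).trans ?_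
  rw [mul_assoc]
  gcongr
  have hpreS : MeasurableSet {v : (Submodule.span ℝ {ν})ᗮ | (v : Euc N) + γ v • ν ∈ S} := by
    have : Continuous fun v : (Submodule.span ℝ {ν})ᗮ => (v : Euc N) + γ v • ν := by fun_prop
    exact this.measurable hSm
  calc ∫⁻ v : (Submodule.span ℝ {ν})ᗮ in {v : (Submodule.span ℝ {ν})ᗮ | (v : Euc N) + γ v • ν ∈ S},
        ‖φ (v + γ v • ν)‖ₑ ^ p
      ≤ ∫⁻ v : (Submodule.span ℝ {ν})ᗮ in {v : (Submodule.span ℝ {ν})ᗮ | (v : Euc N) + γ v • ν ∈ S},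
          C₁ * ∫⁻ t : ℝ, Ω.indicator g (v + t • ν) := by
        refine setLIntegral_mono' hpreS fun v hv => ?_
        refine (enorm_rpow_le_lintegral_along hp hhpos hφ hν _).trans ?_
        refine mul_le_mul_right ?_ _
        calc ∫⁻ t in Set.Ioo 0 h, g ((v : Euc N) + γ v • ν + t • ν)
            ≤ ∫⁻ t in Set.Ioo 0 h, Ω.indicator g ((v : Euc N) + (γ v + t) • ν) := by
              refine setLIntegral_mono' measurableSet_Ioo fun t ht => ?_
              have hmem := hin _ hv t ht
              rw [add_smul, ← add_assoc, Set.indicator_of_mem hmem]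
          _ ≤ ∫⁻ t : ℝ, Ω.indicator g ((v : Euc N) + (γ v + t) • ν) := setLIntegral_le_lintegral _ _
          -- Translation invariance in `t` removes the height `γ v` of the graph.
          _ = ∫⁻ t : ℝ, Ω.indicator g (v + t • ν) :=
              lintegral_add_left_eq_self (fun t => Ω.indicator g ((v : Euc N) + t • ν)) (γ v)
    _ ≤ ∫⁻ v : (Submodule.span ℝ {ν})ᗮ, C₁ * ∫⁻ t : ℝ, Ω.indicator g (v + t • ν) :=
        setLIntegral_le_lintegral _ _
    _ = C₁ * ∫⁻ y in Ω, g y := by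
        rw [lintegral_const_mul' _ _ hC₁top, ← lintegral_eq_lintegral_orthogonal hν hIm,
          lintegral_indicator hΩ.isOpen.measurableSet]

theorem IsSmoothBoundedDomain.isCompact_frontier {Ω : Set (Euc N)}
    (hΩ : IsSmoothBoundedDomain Ω) : IsCompact (frontier Ω) :=
  Metric.isCompact_of_isClosed_isBounded isClosed_frontier
    (hΩ.isBounded.closure.subset frontier_subset_closure)

theorem trace_inequality {Ω : Set (Euc N)} (hΩ : IsSmoothBoundedDomain Ω) {p : ℝ}
    (hp : 1 < p) :
    ∃ C : ENNReal, C ≠ ⊤ ∧ ∀ φ : Euc N → ℝ, ContDiff ℝ ∞ φ →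
      ∫⁻ y, ‖φ y‖ₑ ^ p ∂(surfaceMeasure Ω) ≤
        C * ∫⁻ y in Ω, (‖φ y‖ₑ ^ p + ‖gradient φ y‖ₑ ^ p) := by
  have key : ∃ C : ENNReal, C ≠ ⊤ ∧ ∀ φ : Euc N → ℝ, ContDiff ℝ ∞ φ →
      ∫⁻ y in frontier Ω, ‖φ y‖ₑ ^ p ∂(surfaceMeasure Ω) ≤
        C * ∫⁻ y in Ω, (‖φ y‖ₑ ^ p + ‖gradient φ y‖ₑ ^ p) := by
    refine hΩ.isCompact_frontier.induction_on (p := fun S => ∃ C : ENNReal, C ≠ ⊤ ∧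
      ∀ φ : Euc N → ℝ, ContDiff ℝ ∞ φ → ∫⁻ y in S, ‖φ y‖ₑ ^ p ∂(surfaceMeasure Ω) ≤
        C * ∫⁻ y in Ω, (‖φ y‖ₑ ^ p + ‖gradient φ y‖ₑ ^ p)) ?_ ?_ ?_ ?_
    · exact ⟨0, by simp, fun φ _ => by simp⟩
    · rintro s t hst ⟨C, hC, h⟩
      exact ⟨C, hC, fun φ hφ => (lintegral_mono_set hst).trans (h φ hφ)⟩
    · rintro s t ⟨C, hC, h⟩ ⟨C', hC', h'⟩
      refine ⟨C + C', ENNReal.add_ne_top.2 ⟨hC, hC'⟩, fun φ hφ => ?_⟩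
      refine (lintegral_union_le _ _ _).trans ?_
      rw [add_mul]
      exact add_le_add (h φ hφ) (h' φ hφ)
    · intro x hx
      obtain ⟨ρ, hρ, h⟩ := trace_inequality_near hΩ hp hx
      exact ⟨_, mem_nhdsWithin_of_mem_nhds (Metric.ball_mem_nhds x hρ), h⟩
  have hres : (surfaceMeasure Ω).restrict (frontier Ω) = surfaceMeasure Ω := by
    rw [surfaceMeasure, Measure.restrict_restrict isClosed_frontier.measurableSet, Set.inter_self]
  rwa [hres] at key

theorem IsSmoothBoundedDomain.isFiniteMeasure_surfaceMeasure {Ω : Set (Euc N)}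
    (hΩ : IsSmoothBoundedDomain Ω) : IsFiniteMeasure (surfaceMeasure Ω) := by
  -- Applied to `φ = 1` it bounds the boundary measure by `C * volume Ω`; any exponent above `1`
  -- would serve.
  obtain ⟨C, hC, h⟩ := trace_inequality hΩ one_lt_two
  have h1 := h (fun _ => 1) contDiff_const
  have hgrad : ∀ y : Euc N, gradient (fun _ : Euc N => (1 : ℝ)) y = 0 := fun y => by
    simp [gradient]
  simp only [hgrad] at h1
  refine ⟨?_⟩
  have h2 : volume Ω < ⊤ := hΩ.isBounded.measure_lt_top
  simp at h1
  exact lt_of_le_of_lt h1 (ENNReal.mul_lt_top hC.lt_top h2)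

end Geometry

/-! ### The direct method by uniform convexity. -/

section Minimization

/-- Uniform convexity of the `p`-th power of the norm on bounded sets. -/
def UniformlyConvexPow (p : ℝ) (A : Type*) [NormedAddCommGroup A] [NormedSpace ℝ A] : Prop :=
  ∀ ε : ℝ, 0 < ε → ∃ C : ℝ, 0 ≤ C ∧ ∀ a b : A, ‖a - b‖ ^ p ≤ ε * (‖a‖ ^ p + ‖b‖ ^ p) +
    C * ((‖a‖ ^ p + ‖b‖ ^ p) / 2 - ‖(1 / 2 : ℝ) • (a + b)‖ ^ p)

theorem norm_rpow_lp_eq_integral {α : Type*} [MeasurableSpace α] {μ : Measure α} {F : Type*}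
    [NormedAddCommGroup F] {p : ℝ} (hp : 1 < p) (f : Lp F (ENNReal.ofReal p) μ) :
    ‖f‖ ^ p = ∫ x, ‖f x‖ ^ p ∂μ := by
  have hp0 : 0 < p := by linarith
  rw [Lp.norm_def, (Lp.memLp f).eLpNorm_eq_integral_rpow_norm (by simpa using hp0)
    ENNReal.ofReal_ne_top, ENNReal.toReal_ofReal hp0.le, ENNReal.toReal_ofReal (by positivity),
    ← Real.rpow_mul (by positivity), inv_mul_cancel₀ hp0.ne', Real.rpow_one]

theorem uniformlyConvexPow_lp {α : Type*} [MeasurableSpace α] (μ : Measure α) (F : Type*)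
    [NormedAddCommGroup F] [InnerProductSpace ℝ F] [FiniteDimensional ℝ F] {p : ℝ} (hp : 1 < p)
    [Fact (1 ≤ ENNReal.ofReal p)] : UniformlyConvexPow p (Lp F (ENNReal.ofReal p) μ) := by
  intro ε hε
  obtain ⟨C, hC, h⟩ := exists_norm_sub_rpow_le (F := F) hp hε
  refine ⟨C, hC, fun a b => ?_⟩
  simp only [norm_rpow_lp_eq_integral hp]
  have ha := (Lp.memLp a).integrable_norm_rpow_ofReal hp
  have hb := (Lp.memLp b).integrable_norm_rpow_ofReal hp
  have hm := (Lp.memLp ((1 / 2 : ℝ) • (a + b))).integrable_norm_rpow_ofReal hp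
  have hd := (Lp.memLp (a - b)).integrable_norm_rpow_ofReal hp
  have hab : Integrable (fun x => ‖a x‖ ^ p + ‖b x‖ ^ p) μ := ha.add hb
  have h2 : Integrable (fun x => (‖a x‖ ^ p + ‖b x‖ ^ p) / 2 -
      ‖((1 / 2 : ℝ) • (a + b) : Lp F (ENNReal.ofReal p) μ) x‖ ^ p) μ := (hab.div_const 2).sub hm
  have key : ∫ x, ‖(a - b : Lp F (ENNReal.ofReal p) μ) x‖ ^ p ∂μ ≤
      ∫ x, (ε * (‖a x‖ ^ p + ‖b x‖ ^ p) + C * ((‖a x‖ ^ p + ‖b x‖ ^ p) / 2 -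
        ‖((1 / 2 : ℝ) • (a + b) : Lp F (ENNReal.ofReal p) μ) x‖ ^ p)) ∂μ := by
    refine integral_mono_ae hd ((hab.const_mul ε).add (h2.const_mul C)) ?_
    filter_upwards [Lp.coeFn_sub a b, Lp.coeFn_smul (1 / 2 : ℝ) (a + b), Lp.coeFn_add a b]
      with x h3 h4 h5
    rw [h3, h4, Pi.smul_apply, h5]
    exact h (a x) (b x)
  rw [integral_add (hab.const_mul ε) (h2.const_mul C), integral_const_mul, integral_const_mul,
    integral_sub (hab.div_const 2) hm, integral_div, integral_add ha hb] at key
  exact key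

variable {A B W : Type*} [NormedAddCommGroup A] [NormedSpace ℝ A] [NormedAddCommGroup B]
  [NormedSpace ℝ B] [NormedAddCommGroup W] [NormedSpace ℝ W]

/-- The energy `(‖u‖^p + ‖G‖^p) / p - ℓ(w)` of a triple `(u, G, w)`. -/
noncomputable def tripleEnergy (p : ℝ) (ℓ : W →L[ℝ] ℝ) (z : A × B × W) : ℝ :=
  (‖z.1‖ ^ p + ‖z.2.1‖ ^ p) / p - ℓ z.2.2

theorem continuous_tripleEnergy {A B : Type*} [NormedAddCommGroup A] [NormedAddCommGroup B]
    {p : ℝ} (hp : 1 < p) (ℓ : W →L[ℝ] ℝ) :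
    Continuous (tripleEnergy p ℓ : A × B × W → ℝ) := by
  have h : Continuous fun x : ℝ => x ^ p := Real.continuous_rpow_const (by linarith)
  exact (((h.comp continuous_fst.norm).add
    (h.comp continuous_snd.fst.norm)).div_const p).sub (ℓ.continuous.comp continuous_snd.snd)

/-- Coercivity: the linear term grows like a first power, so Young's inequality absorbs it into half
of the norm part. -/
theorem exists_tripleEnergy_lower_bound {p : ℝ} (hp : 1 < p) (ℓ : W →L[ℝ] ℝ) {C : ℝ}
    (hC : 0 ≤ C) {Y : Submodule ℝ (A × B × W)}
    (hY : ∀ z ∈ Y, ‖z.2.2‖ ^ p ≤ C * (‖z.1‖ ^ p + ‖z.2.1‖ ^ p)) :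
    ∃ M : ℝ, ∀ z ∈ Y, ‖z.1‖ ^ p + ‖z.2.1‖ ^ p ≤ 2 * p * (tripleEnergy p ℓ z + M) := by
  have hp0 : 0 < p := by linarith
  -- Chosen so that `‖ℓ‖ * C ≤ D / 2`; `x` is then the Young parameter with `x ^ (p - 1) = D`.
  set D : ℝ := 2 * ‖ℓ‖ * C + 1 with hD
  have hDpos : 0 < D := by positivity
  set x : ℝ := D ^ (1 / (p - 1)) with hx
  have hxp : x ^ (p - 1) = D := by
    rw [hx, ← Real.rpow_mul hDpos.le, one_div_mul_cancel (by linarith), Real.rpow_one]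
  have hx0 : 0 ≤ x := by positivity
  refine ⟨‖ℓ‖ * ((p - 1) * x ^ p) / p, fun z hz => ?_⟩
  set n := ‖z.1‖ ^ p + ‖z.2.1‖ ^ p with hn
  have hn0 : 0 ≤ n := by positivity
  have h1 := rpow_sub_one_mul_le hp hx0 (norm_nonneg z.2.2)
  rw [hxp] at h1
  have h2 := hY z hz
  have h3 : |ℓ z.2.2| ≤ ‖ℓ‖ * ‖z.2.2‖ := ℓ.le_opNorm _
  have h4 : ℓ z.2.2 ≤ ‖ℓ‖ * ‖z.2.2‖ := (le_abs_self _).trans h3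
  have hK : 0 ≤ (p - 1) * x ^ p := mul_nonneg (by linarith) (by positivity)
  have h5 : p * (‖ℓ‖ * ‖z.2.2‖) * D ≤ ‖ℓ‖ * ((p - 1) * x ^ p) + ‖ℓ‖ * C * n := by
    have := mul_le_mul_of_nonneg_left (h1.trans (add_le_add_right h2 _)) (norm_nonneg ℓ)
    linarith
  have h6 : p * (‖ℓ‖ * ‖z.2.2‖) ≤ ‖ℓ‖ * ((p - 1) * x ^ p) + n / 2 := by
    refine le_of_mul_le_mul_right ?_ hDpos
    have h7 : 0 ≤ ‖ℓ‖ * ((p - 1) * x ^ p) * (2 * ‖ℓ‖ * C) := by positivity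
    have h8 : ‖ℓ‖ * C * n ≤ n / 2 * D := by
      rw [hD]
      nlinarith
    nlinarith
  have h9 : 2 * p * (tripleEnergy p ℓ z + ‖ℓ‖ * ((p - 1) * x ^ p) / p) =
      2 * n - 2 * p * ℓ z.2.2 + 2 * (‖ℓ‖ * ((p - 1) * x ^ p)) := by
    rw [tripleEnergy, ← hn]
    field_simp
  rw [h9]
  nlinarith

/-- The midpoint of two almost-minimizers lies in `Y` and has energy at least the infimum. As `ℓ` is
linear, their convexity defect is therefore small, and uniform convexity makes the minimizing
sequence Cauchy; no weak compactness is involved. -/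
theorem exists_isMinOn_tripleEnergy [CompleteSpace A] [CompleteSpace B] [CompleteSpace W]
    {p : ℝ} (hp : 1 < p) (hA : UniformlyConvexPow p A) (hB : UniformlyConvexPow p B)
    (ℓ : W →L[ℝ] ℝ) {C : ℝ} (hC : 0 ≤ C) {Y : Submodule ℝ (A × B × W)}
    (hYc : IsClosed (Y : Set (A × B × W)))
    (hY : ∀ z ∈ Y, ‖z.2.2‖ ^ p ≤ C * (‖z.1‖ ^ p + ‖z.2.1‖ ^ p)) :
    ∃ z ∈ Y, IsMinOn (tripleEnergy p ℓ) (Y : Set (A × B × W)) z := by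
  have hp0 : 0 < p := by linarith
  obtain ⟨M, hM⟩ := exists_tripleEnergy_lower_bound hp ℓ hC hY
  set E : A × B × W → ℝ := tripleEnergy p ℓ with hE
  set n : A × B × W → ℝ := fun z => ‖z.1‖ ^ p + ‖z.2.1‖ ^ p with hn
  have hn0 : ∀ z, 0 ≤ n z := fun z => by positivity
  have hbdd : BddBelow (E '' Y) := by
    refine ⟨-M, ?_⟩
    rintro _ ⟨z, hz, rfl⟩
    have h1 := (hn0 z).trans (hM z hz)
    have h2 : 0 ≤ E z + M := by
      by_contra! hlt
      have : 2 * p * (E z + M) < 0 := mul_neg_of_pos_of_neg (by positivity) hlt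
      linarith
    linarith
  obtain ⟨e, hanti, hlim, hmem⟩ := exists_seq_tendsto_sInf
    (Set.Nonempty.image E ⟨0, Y.zero_mem⟩) hbdd
  choose z hzY hze using hmem
  set m := sInf (E '' Y) with hm
  have hmle : ∀ y ∈ Y, m ≤ E y := fun y hy => csInf_le hbdd ⟨y, hy, rfl⟩
  set R : ℝ := 2 * p * (e 0 + M) with hR
  have hnR : ∀ k, n (z k) ≤ R := fun k => by
    have h1 := hM _ (hzY k)
    rw [hze] at h1
    have h2 := mul_le_mul_of_nonneg_left (hanti (Nat.zero_le k)) (by positivity : 0 ≤ 2 * p)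
    rw [hR]
    linarith
  have hR0 : 0 ≤ R := (hn0 _).trans (hnR 0)
  have hdefect : ∀ j k, (n (z j) + n (z k)) / 2 - n ((1 / 2 : ℝ) • (z j + z k)) ≤
      p * ((e j - m) / 2 + (e k - m) / 2) := by
    intro j k
    have hmid : (1 / 2 : ℝ) • (z j + z k) ∈ Y := Y.smul_mem _ (Y.add_mem (hzY j) (hzY k))
    have h1 := hmle _ hmid
    have hEn : ∀ y, p * E y = n y - p * ℓ y.2.2 := fun y => by
      simp only [hE, tripleEnergy, hn]
      field_simp
    have h2 := hEn ((1 / 2 : ℝ) • (z j + z k))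
    have h3 := hEn (z j)
    have h4 := hEn (z k)
    rw [hze] at h3 h4
    have h5 : ℓ ((1 / 2 : ℝ) • (z j + z k)).2.2 = (ℓ (z j).2.2 + ℓ (z k).2.2) / 2 := by
      simp only [Prod.smul_snd, Prod.snd_add, map_smul, map_add, smul_eq_mul]
      ring
    rw [h5] at h2
    have h6 := mul_le_mul_of_nonneg_left h1 hp0.le
    linarith
  have hsmall : ∀ δ : ℝ, 0 < δ → ∃ K, ∀ j ≥ K, ∀ k ≥ K, n (z j - z k) < δ := by
    intro δ hδ
    -- Along the sequence `n ≤ R`, so the `ε` term costs at most `δ / 2`; the threshold on `e k`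
    -- leaves the defect term less than `δ / 2`.
    set ε : ℝ := δ / (4 * (R + 1)) with hε
    have hεpos : 0 < ε := by positivity
    obtain ⟨C₁, hC₁, h₁⟩ := hA ε hεpos
    obtain ⟨C₂, hC₂, h₂⟩ := hB ε hεpos
    set D := C₁ + C₂ with hD
    have hD0 : 0 ≤ D := by positivity
    have hev : ∀ᶠ k in atTop, e k < m + δ / (2 * (D * p + 1)) :=
      hlim.eventually (gt_mem_nhds (by
        have : 0 < δ / (2 * (D * p + 1)) := by positivity
        linarith))
    obtain ⟨K, hK⟩ := eventually_atTop.1 hev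
    refine ⟨K, fun j hj k hk => ?_⟩
    set a := z j
    set b := z k
    have g1 := h₁ a.1 b.1
    have g2 := h₂ a.2.1 b.2.1
    have hdA := sub_nonneg.2 (norm_midpoint_rpow_le hp a.1 b.1)
    have hdB := sub_nonneg.2 (norm_midpoint_rpow_le hp a.2.1 b.2.1)
    have hsum := hdefect j k
    have hej := hK j hj
    have hek := hK k hk
    set dA := (‖a.1‖ ^ p + ‖b.1‖ ^ p) / 2 - ‖(1 / 2 : ℝ) • (a.1 + b.1)‖ ^ p with hdAdef
    set dB := (‖a.2.1‖ ^ p + ‖b.2.1‖ ^ p) / 2 - ‖(1 / 2 : ℝ) • (a.2.1 + b.2.1)‖ ^ p with hdBdef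
    have hdd : (n a + n b) / 2 - n ((1 / 2 : ℝ) • (a + b)) = dA + dB := by
      simp only [hn, hdAdef, hdBdef, Prod.smul_fst, Prod.smul_snd, Prod.fst_add, Prod.snd_add]
      ring
    have hnab : n (a - b) ≤ ε * (n a + n b) + D * (dA + dB) := by
      simp only [hn, Prod.fst_sub, Prod.snd_sub]
      rw [hD]
      nlinarith [mul_nonneg hC₁ hdB, mul_nonneg hC₂ hdA]
    have hRj := hnR j
    have hRk := hnR k
    have t1 : ε * (n a + n b) ≤ δ / 2 := by
      calc ε * (n a + n b) ≤ ε * (2 * (R + 1)) := by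
            gcongr
            linarith
        _ = δ / 2 := by
            rw [hε]
            field_simp
            ring
    have t2 : D * (dA + dB) < δ / 2 := by
      calc D * (dA + dB) ≤ D * (p * (δ / (2 * (D * p + 1)))) := by
            gcongr
            rw [← hdd]
            refine hsum.trans ?_
            gcongr
            linarith
        _ = δ / 2 * ((D * p) / (D * p + 1)) := by
            field_simp
        _ < δ / 2 * 1 := by
            gcongr
            rw [div_lt_one (by positivity)]
            linarith
        _ = δ / 2 := mul_one _
    linarith
  have hcauchy : CauchySeq z := by
    rw [Metric.cauchySeq_iff]
    intro η hη
    -- The factor `C + 1` serves all three components, the boundary one through `hY`.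
    obtain ⟨K, hK⟩ := hsmall (η ^ p / (C + 1)) (by positivity)
    refine ⟨K, fun j hj k hk => ?_⟩
    have h1 := hK j hj k hk
    have h2 := hY _ (Y.sub_mem (hzY j) (hzY k))
    have h3 : (C + 1) * n (z j - z k) < η ^ p := by
      rw [lt_div_iff₀ (by positivity)] at h1
      linarith
    have hle : ∀ y : ℝ, 0 ≤ y → y ^ p ≤ (C + 1) * n (z j - z k) → y < η := fun y hy h =>
      (Real.rpow_lt_rpow_iff hy hη.le hp0).1 (lt_of_le_of_lt h h3)
    have p1 : 0 ≤ ‖(z j - z k).1‖ ^ p := by positivity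
    have p2 : 0 ≤ ‖(z j - z k).2.1‖ ^ p := by positivity
    have q := hn0 (z j - z k)
    have q' : n (z j - z k) = ‖(z j - z k).1‖ ^ p + ‖(z j - z k).2.1‖ ^ p := rfl
    rw [dist_eq_norm, Prod.norm_def, Prod.norm_def]
    refine max_lt (hle _ (norm_nonneg _) ?_) (max_lt (hle _ (norm_nonneg _) ?_)
      (hle _ (norm_nonneg _) ?_))
    · nlinarith
    · nlinarith
    · exact h2.trans (mul_le_mul_of_nonneg_right (by linarith) q)
  obtain ⟨z₀, hz₀⟩ := cauchySeq_tendsto_of_complete hcauchy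
  have hz₀Y : z₀ ∈ Y := hYc.mem_of_tendsto hz₀ (Eventually.of_forall hzY)
  have hE₀ : E z₀ = m := by
    have h1 := ((continuous_tripleEnergy hp ℓ).tendsto z₀).comp hz₀
    refine tendsto_nhds_unique h1 (hlim.congr fun k => ?_)
    exact (hze k).symm
  exact ⟨z₀, hz₀Y, fun y hy => by
    show E z₀ ≤ E y
    rw [hE₀]
    exact hmle y hy⟩

end Minimization

/-! ### The Euler–Lagrange equation of the energy. -/

section EulerLagrange

variable {α : Type*} [MeasurableSpace α] {μ : Measure α} {F G : Type*} [NormedAddCommGroup F]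
  [InnerProductSpace ℝ F] [NormedAddCommGroup G] [InnerProductSpace ℝ G]
  {W : Type*} [NormedAddCommGroup W] [NormedSpace ℝ W]

/-- The tangent inequality with base point `f + t • g`, evaluated at `f`; thus an upper bound is
obtained without differentiating the norm. -/
theorem norm_rpow_lp_add_smul_le {p : ℝ} (hp : 1 < p) [Fact (1 ≤ ENNReal.ofReal p)]
    (f g : Lp F (ENNReal.ofReal p) μ) (t : ℝ) :
    ‖f + t • g‖ ^ p ≤ ‖f‖ ^ p +
      p * (t * ∫ x, ‖f x + t • g x‖ ^ (p - 2) * inner ℝ (f x + t • g x) (g x) ∂μ) := by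
  have hae : (f + t • g : Lp F (ENNReal.ofReal p) μ) =ᵐ[μ] fun x => f x + t • g x := by
    filter_upwards [Lp.coeFn_add f (t • g), Lp.coeFn_smul t g] with x h1 h2
    rw [h1, Pi.add_apply, h2, Pi.smul_apply]
  have h := integral_norm_rpow_tangent_le hp (Lp.memLp f) ((Lp.memLp f).add
    ((Lp.memLp g).const_smul t))
  have h1 : ‖f + t • g‖ ^ p = ∫ x, ‖f x + t • g x‖ ^ p ∂μ := by
    rw [norm_rpow_lp_eq_integral hp]
    refine integral_congr_ae ?_
    filter_upwards [hae] with x hx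
    rw [hx]
  have h2 : ∀ x, ‖f x + t • g x‖ ^ (p - 2) * inner ℝ (f x + t • g x) (f x - (f x + t • g x)) =
      -t * (‖f x + t • g x‖ ^ (p - 2) * inner ℝ (f x + t • g x) (g x)) := fun x => by
    rw [show f x - (f x + t • g x) = (-t) • g x by rw [sub_add_cancel_left, neg_smul],
      inner_smul_right]
    ring
  simp only [Pi.add_apply, Pi.smul_apply, h2] at h
  rw [integral_const_mul, ← h1, ← norm_rpow_lp_eq_integral hp] at h
  linarith

/-- Compare the energies at `z` and `z + t • v`, divide by `t > 0` and let `t → 0`. The reverse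
inequality comes from `-v`. -/
theorem le_pairing_of_isMinOn_tripleEnergy {p : ℝ} (hp : 1 < p) [Fact (1 ≤ ENNReal.ofReal p)]
    (ℓ : W →L[ℝ] ℝ)
    {Y : Submodule ℝ (Lp F (ENNReal.ofReal p) μ × Lp G (ENNReal.ofReal p) μ × W)}
    {z v : Lp F (ENNReal.ofReal p) μ × Lp G (ENNReal.ofReal p) μ × W} (hz : z ∈ Y) (hv : v ∈ Y)
    (hmin : IsMinOn (tripleEnergy p ℓ) (Y : Set _) z) :
    ℓ v.2.2 ≤ ∫ x, ‖z.1 x‖ ^ (p - 2) * inner ℝ (z.1 x) (v.1 x) ∂μ +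
      ∫ x, ‖z.2.1 x‖ ^ (p - 2) * inner ℝ (z.2.1 x) (v.2.1 x) ∂μ := by
  have hp0 : 0 < p := by linarith
  have hlim := (tendsto_integral_norm_rpow_sub_two_mul_inner hp (Lp.memLp z.1)
    (Lp.memLp v.1)).add (tendsto_integral_norm_rpow_sub_two_mul_inner hp (Lp.memLp z.2.1)
    (Lp.memLp v.2.1))
  refine ge_of_tendsto hlim ?_
  filter_upwards [self_mem_nhdsWithin] with t ht
  have ht0 : (0 : ℝ) < t := ht
  have h1 : tripleEnergy p ℓ z ≤ tripleEnergy p ℓ (z + t • v) :=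
    hmin (Y.add_mem hz (Y.smul_mem t hv))
  have h2 := norm_rpow_lp_add_smul_le hp z.1 v.1 t
  have h3 := norm_rpow_lp_add_smul_le hp z.2.1 v.2.1 t
  set P := ∫ x, ‖z.1 x + t • v.1 x‖ ^ (p - 2) * inner ℝ (z.1 x + t • v.1 x) (v.1 x) ∂μ
  set Q := ∫ x, ‖z.2.1 x + t • v.2.1 x‖ ^ (p - 2) *
    inner ℝ (z.2.1 x + t • v.2.1 x) (v.2.1 x) ∂μ
  have e1 : (z + t • v).1 = z.1 + t • v.1 := rfl
  have e2 : (z + t • v).2.1 = z.2.1 + t • v.2.1 := rfl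
  have e3 : ℓ (z + t • v).2.2 = ℓ z.2.2 + t * ℓ v.2.2 := by
    simp [map_add, map_smul]
  simp only [tripleEnergy, e1, e2, e3] at h1
  have h4 : (‖z.1 + t • v.1‖ ^ p + ‖z.2.1 + t • v.2.1‖ ^ p) / p ≤
      (‖z.1‖ ^ p + ‖z.2.1‖ ^ p) / p + t * (P + Q) := by
    rw [div_add' _ _ _ hp0.ne', div_le_div_iff_of_pos_right hp0]
    linarith
  have h5 : t * ℓ v.2.2 ≤ t * (P + Q) := by linarith
  exact le_of_mul_le_mul_left h5 ht0

theorem pairing_eq_of_isMinOn_tripleEnergy {p : ℝ} (hp : 1 < p) [Fact (1 ≤ ENNReal.ofReal p)]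
    (ℓ : W →L[ℝ] ℝ)
    {Y : Submodule ℝ (Lp F (ENNReal.ofReal p) μ × Lp G (ENNReal.ofReal p) μ × W)}
    {z v : Lp F (ENNReal.ofReal p) μ × Lp G (ENNReal.ofReal p) μ × W} (hz : z ∈ Y) (hv : v ∈ Y)
    (hmin : IsMinOn (tripleEnergy p ℓ) (Y : Set _) z) :
    ∫ x, ‖z.1 x‖ ^ (p - 2) * inner ℝ (z.1 x) (v.1 x) ∂μ +
      ∫ x, ‖z.2.1 x‖ ^ (p - 2) * inner ℝ (z.2.1 x) (v.2.1 x) ∂μ = ℓ v.2.2 := by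
  have h1 := le_pairing_of_isMinOn_tripleEnergy hp ℓ hz hv hmin
  have h2 := le_pairing_of_isMinOn_tripleEnergy hp ℓ hz (Y.neg_mem hv) hmin
  have e1 : ∫ x, ‖z.1 x‖ ^ (p - 2) * inner ℝ (z.1 x) ((-v).1 x) ∂μ =
      -∫ x, ‖z.1 x‖ ^ (p - 2) * inner ℝ (z.1 x) (v.1 x) ∂μ := by
    rw [← integral_neg]
    refine integral_congr_ae ?_
    filter_upwards [Lp.coeFn_neg v.1] with x hx
    rw [Prod.fst_neg, hx, Pi.neg_apply, inner_neg_right, mul_neg]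
  have e2 : ∫ x, ‖z.2.1 x‖ ^ (p - 2) * inner ℝ (z.2.1 x) ((-v).2.1 x) ∂μ =
      -∫ x, ‖z.2.1 x‖ ^ (p - 2) * inner ℝ (z.2.1 x) (v.2.1 x) ∂μ := by
    rw [← integral_neg]
    refine integral_congr_ae ?_
    filter_upwards [Lp.coeFn_neg v.2.1] with x hx
    rw [Prod.snd_neg, Prod.fst_neg, hx, Pi.neg_apply, inner_neg_right, mul_neg]
  have e3 : ℓ (-v).2.2 = -ℓ v.2.2 := by simp
  rw [e1, e2, e3] at h2
  linarith

end EulerLagrange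

/-! ### Smooth functions as Sobolev functions; uniqueness of weak gradients. -/

section Smooth

variable {N : ℕ}

theorem memLp_of_continuous_of_isCompact {E F : Type*} [TopologicalSpace E] [MeasurableSpace E]
    [OpensMeasurableSpace E] [NormedAddCommGroup F] [SecondCountableTopologyEither E F]
    {μ : Measure E} [IsFiniteMeasure μ] {K : Set E} (hK : IsCompact K) (hμ : ∀ᵐ x ∂μ, x ∈ K)
    {f : E → F} (hf : Continuous f) (q : ENNReal) : MemLp f q μ := by
  obtain ⟨C, hC⟩ := hK.exists_bound_of_continuousOn hf.continuousOn
  refine MemLp.of_bound hf.aestronglyMeasurable C ?_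
  filter_upwards [hμ] with x hx
  exact hC x hx

theorem continuous_gradient_of_contDiff {φ : Euc N → ℝ} (hφ : ContDiff ℝ ∞ φ) :
    Continuous (gradient φ) :=
  ((InnerProductSpace.toDual ℝ (Euc N)).symm.continuous).comp (hφ.continuous_fderiv (by simp))

theorem inner_gradient_eq_fderiv (φ : Euc N → ℝ) (x c : Euc N) :
    inner ℝ c (gradient φ x) = fderiv ℝ φ x c := by
  rw [real_inner_comm]
  exact InnerProductSpace.toDual_symm_apply

variable {Ω : Set (Euc N)}

theorem IsSmoothBoundedDomain.isFiniteMeasure_volume (hΩ : IsSmoothBoundedDomain Ω) :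
    IsFiniteMeasure (volume.restrict Ω) :=
  ⟨by simpa using hΩ.isBounded.measure_lt_top⟩

theorem IsSmoothBoundedDomain.memLp_volume (hΩ : IsSmoothBoundedDomain Ω) {F : Type*}
    [NormedAddCommGroup F] {f : Euc N → F} (hf : Continuous f)
    (q : ENNReal) : MemLp f q (volume.restrict Ω) := by
  have := hΩ.isFiniteMeasure_volume
  refine memLp_of_continuous_of_isCompact
    (Metric.isCompact_of_isClosed_isBounded isClosed_closure hΩ.isBounded.closure) ?_ hf q
  rw [ae_restrict_iff' hΩ.isOpen.measurableSet]
  exact ae_of_all _ fun x hx => subset_closure hx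

theorem IsSmoothBoundedDomain.memLp_surface (hΩ : IsSmoothBoundedDomain Ω) {F : Type*}
    [NormedAddCommGroup F] {f : Euc N → F} (hf : Continuous f)
    (q : ENNReal) : MemLp f q (surfaceMeasure Ω) := by
  have := hΩ.isFiniteMeasure_surfaceMeasure
  refine memLp_of_continuous_of_isCompact hΩ.isCompact_frontier ?_ hf q
  rw [surfaceMeasure, ae_restrict_iff' isClosed_frontier.measurableSet]
  exact ae_of_all _ fun x hx => hx

theorem gradient_eq_zero_of_notMem_tsupport {φ : Euc N → ℝ} {x : Euc N} (hx : x ∉ tsupport φ) :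
    gradient φ x = 0 := by
  have : fderiv ℝ φ x = 0 := by
    by_contra h
    exact hx (support_fderiv_subset ℝ h)
  rw [gradient, this, map_zero]

theorem hasWeakGradient_of_contDiff {ψ : Euc N → ℝ} (hψ : ContDiff ℝ ∞ ψ) :
    HasWeakGradient Ω ψ (gradient ψ) := by
  intro φ hφ hc hs
  have hφ0 : ∀ x, x ∉ Ω → φ x = 0 := fun x hx => image_eq_zero_of_notMem_tsupport fun h =>
    hx (hs h)
  have hg0 : ∀ x, x ∉ Ω → gradient φ x = 0 := fun x hx =>
    gradient_eq_zero_of_notMem_tsupport fun h => hx (hs h)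
  rw [setIntegral_eq_integral_of_forall_compl_eq_zero fun x hx => by rw [hg0 x hx, smul_zero],
    setIntegral_eq_integral_of_forall_compl_eq_zero fun x hx => by rw [hφ0 x hx, zero_smul]]
  have hcg : HasCompactSupport (gradient φ) := hc.mono' fun x hx => by
    by_contra h
    exact hx (gradient_eq_zero_of_notMem_tsupport h)
  have hi1 : Integrable fun x => ψ x • gradient φ x :=
    (hψ.continuous.smul (continuous_gradient_of_contDiff hφ)).integrable_of_hasCompactSupport
      hcg.smul_left
  have hi2 : Integrable fun x => φ x • gradient ψ x :=
    (hφ.continuous.smul (continuous_gradient_of_contDiff hψ)).integrable_of_hasCompactSupport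
      hc.smul_right
  have hi3 : Integrable fun x => ψ x * φ x :=
    (hψ.continuous.mul hφ.continuous).integrable_of_hasCompactSupport hc.mul_left
  -- Pairing with a fixed vector reduces the claim to scalar integration by parts.
  refine ext_inner_left ℝ fun c => ?_
  have hj1 := hi1.const_inner (𝕜 := ℝ) c
  have hj2 := hi2.const_inner (𝕜 := ℝ) c
  rw [inner_neg_right, ← integral_inner hi1, ← integral_inner hi2]
  simp only [inner_smul_right, inner_gradient_eq_fderiv] at hj1 hj2 ⊢
  have hj2' : Integrable fun x => fderiv ℝ ψ x c * φ x := by simpa only [mul_comm] using hj2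
  rw [integral_mul_fderiv_eq_neg_fderiv_mul_of_integrable hj2' hj1 hi3
    (fun x _ => (hψ.differentiable (by simp)) x) (fun x _ => (hφ.differentiable (by simp)) x)]
  simp only [mul_comm]

theorem memSobolev_of_contDiff (hΩ : IsSmoothBoundedDomain Ω) (p : ℝ) {φ : Euc N → ℝ}
    (hφ : ContDiff ℝ ∞ φ) : MemSobolev p Ω φ (gradient φ) :=
  ⟨hΩ.memLp_volume hφ.continuous _, hΩ.memLp_volume (continuous_gradient_of_contDiff hφ) _,
    hasWeakGradient_of_contDiff hφ⟩

theorem isTrace_of_contDiff (hΩ : IsSmoothBoundedDomain Ω) (p : ℝ) {φ : Euc N → ℝ}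
    (hφ : ContDiff ℝ ∞ φ) : IsTrace p Ω φ φ :=
  ⟨hΩ.memLp_surface hφ.continuous _, gradient φ, memSobolev_of_contDiff hΩ p hφ, fun _ => φ,
    fun _ => hφ, by simp, by simp, by simp⟩

/-- Needed because `IsTrace` carries its own weak gradient, which must be identified with the given
one. -/
theorem ae_eq_of_hasWeakGradient (hΩ : IsSmoothBoundedDomain Ω) {p : ℝ} (hp : 1 < p)
    {u : Euc N → ℝ} {G G' : Euc N → Euc N} (h : MemSobolev p Ω u G)
    (h' : MemSobolev p Ω u G') : G =ᵐ[volume.restrict Ω] G' := by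
  have := hΩ.isFiniteMeasure_volume
  have h1p : 1 ≤ ENNReal.ofReal p := by simpa using hp.le
  have hi := h.memLp_grad.integrable h1p
  have hi' := h'.memLp_grad.integrable h1p
  have hloc : LocallyIntegrableOn (fun x => G x - G' x) Ω volume :=
    IntegrableOn.locallyIntegrableOn (hi.sub hi')
  have key := hΩ.isOpen.ae_eq_zero_of_integral_contDiff_smul_eq_zero hloc fun g hg hc hs => by
    have hg0 : ∀ x, x ∉ Ω → g x = 0 := fun x hx => image_eq_zero_of_notMem_tsupport fun h =>
      hx (hs h)
    rw [← setIntegral_eq_integral_of_forall_compl_eq_zero (s := Ω) fun x hx => by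
      rw [hg0 x hx, zero_smul]]
    obtain ⟨C, hC⟩ := hg.continuous.bounded_above_of_compact_support hc
    have hb : ∀ {H : Euc N → Euc N}, Integrable H (volume.restrict Ω) →
        Integrable (fun x => g x • H x) (volume.restrict Ω) := fun hH =>
      hH.bdd_smul C hg.continuous.aestronglyMeasurable (ae_of_all _ hC)
    simp only [smul_sub]
    rw [integral_sub (hb hi) (hb hi')]
    have e1 := h.hasWeakGradient g hg hc hs
    have e2 := h'.hasWeakGradient g hg hc hs
    rw [e1, neg_inj] at e2
    rw [e2, sub_self]
  rw [EventuallyEq, ae_restrict_iff' hΩ.isOpen.measurableSet]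
  filter_upwards [key] with x hx hxΩ
  exact sub_eq_zero.1 (hx hxΩ)

end Smooth

/-! ### The closed space of triples (function, gradient, trace). -/

section Triples

variable {N : ℕ}

/-- The classes of the triples `(φ, ∇φ, φ|_{∂Ω})`, where `φ` is smooth on `ℝ^N`. -/
def smoothTriples (p : ℝ) (Ω : Set (Euc N)) :
    Submodule ℝ (Lp ℝ (ENNReal.ofReal p) (volume.restrict Ω) ×
      Lp (Euc N) (ENNReal.ofReal p) (volume.restrict Ω) ×
      Lp ℝ (ENNReal.ofReal p) (surfaceMeasure Ω)) where
  carrier := {z | ∃ φ : Euc N → ℝ, ContDiff ℝ ∞ φ ∧ z.1 =ᵐ[volume.restrict Ω] φ ∧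
    z.2.1 =ᵐ[volume.restrict Ω] gradient φ ∧ z.2.2 =ᵐ[surfaceMeasure Ω] φ}
  zero_mem' := by
    refine ⟨fun _ => 0, contDiff_const, Lp.coeFn_zero _ _ _, ?_, Lp.coeFn_zero _ _ _⟩
    have : gradient (fun _ : Euc N => (0 : ℝ)) = 0 := by
      ext1 x
      simp [gradient]
    rw [this]
    exact Lp.coeFn_zero _ _ _
  add_mem' := by
    rintro z w ⟨φ, hφ, h1, h2, h3⟩ ⟨ψ, hψ, k1, k2, k3⟩
    have hgrad : gradient (φ + ψ) = gradient φ + gradient ψ := by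
      ext1 x
      simp only [gradient, Pi.add_apply]
      rw [fderiv_add ((hφ.differentiable (by simp)) x) ((hψ.differentiable (by simp)) x), map_add]
    refine ⟨φ + ψ, hφ.add hψ, (Lp.coeFn_add _ _).trans (h1.add k1), ?_,
      (Lp.coeFn_add _ _).trans (h3.add k3)⟩
    rw [hgrad]
    exact (Lp.coeFn_add _ _).trans (h2.add k2)
  smul_mem' := by
    rintro c z ⟨φ, hφ, h1, h2, h3⟩
    have hgrad : gradient (c • φ) = c • gradient φ := by
      ext1 x
      simp only [gradient, Pi.smul_apply]
      rw [fderiv_const_smul ((hφ.differentiable (by simp)) x)]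
      simp
    refine ⟨c • φ, hφ.const_smul c, (Lp.coeFn_smul _ _).trans (h1.const_smul c), ?_,
      (Lp.coeFn_smul _ _).trans (h3.const_smul c)⟩
    rw [hgrad]
    exact (Lp.coeFn_smul _ _).trans (h2.const_smul c)

theorem ofReal_norm_rpow_lp_eq_lintegral {α : Type*} [MeasurableSpace α] {μ : Measure α}
    {F : Type*} [NormedAddCommGroup F] {p : ℝ} (hp : 1 < p) (f : Lp F (ENNReal.ofReal p) μ)
    {g : α → F} (hg : f =ᵐ[μ] g) : ENNReal.ofReal (‖f‖ ^ p) = ∫⁻ x, ‖g x‖ₑ ^ p ∂μ := by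
  rw [norm_rpow_lp_eq_integral hp, ofReal_integral_eq_lintegral_ofReal
    ((Lp.memLp f).integrable_norm_rpow_ofReal hp) (ae_of_all _ fun x => by positivity)]
  refine lintegral_congr_ae ?_
  filter_upwards [hg] with x hx
  rw [hx, ← ENNReal.ofReal_rpow_of_nonneg (norm_nonneg _) (by linarith), ofReal_norm]

variable {Ω : Set (Euc N)} {p : ℝ} [Fact (1 ≤ ENNReal.ofReal p)]

theorem exists_norm_trace_rpow_le (hΩ : IsSmoothBoundedDomain Ω) (hp : 1 < p) :
    ∃ C : ℝ, 0 ≤ C ∧ ∀ z ∈ (smoothTriples p Ω).topologicalClosure,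
      ‖z.2.2‖ ^ p ≤ C * (‖z.1‖ ^ p + ‖z.2.1‖ ^ p) := by
  obtain ⟨C, hC, h⟩ := trace_inequality hΩ hp
  refine ⟨C.toReal, ENNReal.toReal_nonneg, fun z hz => ?_⟩
  have hcont : Continuous fun x : ℝ => x ^ p := Real.continuous_rpow_const (by linarith)
  have hclosed : IsClosed {z : Lp ℝ (ENNReal.ofReal p) (volume.restrict Ω) ×
      Lp (Euc N) (ENNReal.ofReal p) (volume.restrict Ω) ×
      Lp ℝ (ENNReal.ofReal p) (surfaceMeasure Ω) |
      ‖z.2.2‖ ^ p ≤ C.toReal * (‖z.1‖ ^ p + ‖z.2.1‖ ^ p)} :=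
    isClosed_le (hcont.comp continuous_snd.snd.norm) (((hcont.comp continuous_fst.norm).add
      (hcont.comp continuous_snd.fst.norm)).const_mul _)
  refine hclosed.closure_subset_iff.2 (fun w hw => ?_) hz
  obtain ⟨φ, hφ, h1, h2, h3⟩ := hw
  have key := h φ hφ
  have hm : Measurable fun y => ‖φ y‖ₑ ^ p := by
    have := hφ.continuous
    fun_prop
  rw [lintegral_add_left hm, ← ofReal_norm_rpow_lp_eq_lintegral hp _ h1,
    ← ofReal_norm_rpow_lp_eq_lintegral hp _ h2, ← ofReal_norm_rpow_lp_eq_lintegral hp _ h3,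
    ← ENNReal.ofReal_add (by positivity) (by positivity), ← ENNReal.ofReal_toReal hC,
    ← ENNReal.ofReal_mul ENNReal.toReal_nonneg] at key
  exact (ENNReal.ofReal_le_ofReal_iff (by positivity)).1 key

/-- For a fixed test function both sides are continuous in `L^p` by Hölder, so the identity defines
a closed set containing the smooth triples. -/
theorem hasWeakGradient_of_mem_closure (hΩ : IsSmoothBoundedDomain Ω) (hp : 1 < p)
    {z : Lp ℝ (ENNReal.ofReal p) (volume.restrict Ω) ×
      Lp (Euc N) (ENNReal.ofReal p) (volume.restrict Ω) ×
      Lp ℝ (ENNReal.ofReal p) (surfaceMeasure Ω)}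
    (hz : z ∈ (smoothTriples p Ω).topologicalClosure) : HasWeakGradient Ω z.1 z.2.1 := by
  intro η hη hc hs
  have hq := Real.HolderConjugate.conjExponent hp
  have := hq.ennrealOfReal
  have := hq.symm.ennrealOfReal
  have : Fact (1 ≤ ENNReal.ofReal p.conjExponent) := ⟨by simpa using hq.symm.lt.le⟩
  have hη1 := hΩ.memLp_volume hη.continuous (ENNReal.ofReal p.conjExponent)
  have hη2 := hΩ.memLp_volume (continuous_gradient_of_contDiff hη)
    (ENNReal.ofReal p.conjExponent)
  set B := ContinuousLinearMap.lsmul ℝ ℝ (E := Euc N)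
  set P₁ := B.lpPairing (volume.restrict Ω) (ENNReal.ofReal p) (ENNReal.ofReal p.conjExponent)
  set P₂ := B.lpPairing (volume.restrict Ω) (ENNReal.ofReal p.conjExponent) (ENNReal.ofReal p)
    (hη1.toLp η)
  have e1 : ∀ U, P₁ U (hη2.toLp _) = ∫ x in Ω, U x • gradient η x := fun U => by
    rw [ContinuousLinearMap.lpPairing_eq_integral]
    refine integral_congr_ae ?_
    filter_upwards [hη2.coeFn_toLp] with x hx
    rw [hx]
    rfl
  have e2 : ∀ G, P₂ G = ∫ x in Ω, η x • G x := fun G => by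
    rw [ContinuousLinearMap.lpPairing_eq_integral]
    refine integral_congr_ae ?_
    filter_upwards [hη1.coeFn_toLp] with x hx
    rw [hx]
    rfl
  have hclosed : IsClosed {z : Lp ℝ (ENNReal.ofReal p) (volume.restrict Ω) ×
      Lp (Euc N) (ENNReal.ofReal p) (volume.restrict Ω) ×
      Lp ℝ (ENNReal.ofReal p) (surfaceMeasure Ω) | P₁ z.1 (hη2.toLp _) = -P₂ z.2.1} := by
    refine isClosed_eq ?_ ?_
    · exact ((P₁.flip (hη2.toLp _)).continuous).comp continuous_fst
    · exact (P₂.continuous.comp continuous_snd.fst).neg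
  rw [← e1, ← e2]
  refine hclosed.closure_subset_iff.2 (fun w hw => ?_) hz
  obtain ⟨φ, hφ, h1, h2, -⟩ := hw
  have key := hasWeakGradient_of_contDiff (Ω := Ω) hφ η hη hc hs
  show P₁ w.1 (hη2.toLp _) = -P₂ w.2.1
  rw [e1, e2]
  have c1 : ∫ x in Ω, w.1 x • gradient η x = ∫ x in Ω, φ x • gradient η x :=
    integral_congr_ae (h1.mono fun x hx => by simp only [hx])
  have c2 : ∫ x in Ω, η x • w.2.1 x = ∫ x in Ω, η x • gradient φ x :=
    integral_congr_ae (h2.mono fun x hx => by simp only [hx])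
  rw [c1, c2, key]

theorem memSobolev_of_mem_closure (hΩ : IsSmoothBoundedDomain Ω) (hp : 1 < p)
    {z : Lp ℝ (ENNReal.ofReal p) (volume.restrict Ω) ×
      Lp (Euc N) (ENNReal.ofReal p) (volume.restrict Ω) ×
      Lp ℝ (ENNReal.ofReal p) (surfaceMeasure Ω)}
    (hz : z ∈ (smoothTriples p Ω).topologicalClosure) : MemSobolev p Ω z.1 z.2.1 :=
  ⟨Lp.memLp _, Lp.memLp _, hasWeakGradient_of_mem_closure hΩ hp hz⟩

theorem isTrace_of_mem_closure (hΩ : IsSmoothBoundedDomain Ω) (hp : 1 < p)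
    {z : Lp ℝ (ENNReal.ofReal p) (volume.restrict Ω) ×
      Lp (Euc N) (ENNReal.ofReal p) (volume.restrict Ω) ×
      Lp ℝ (ENNReal.ofReal p) (surfaceMeasure Ω)}
    (hz : z ∈ (smoothTriples p Ω).topologicalClosure) : IsTrace p Ω z.1 z.2.2 := by
  obtain ⟨s, hs, hlim⟩ := mem_closure_iff_seq_limit.1 hz
  choose φ hφ h1 h2 h3 using hs
  have l1 := (Lp.tendsto_Lp_iff_tendsto_eLpNorm' _ _).1 hlim.fst_nhds
  have l2 := (Lp.tendsto_Lp_iff_tendsto_eLpNorm' _ _).1 hlim.snd_nhds.fst_nhds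
  have l3 := (Lp.tendsto_Lp_iff_tendsto_eLpNorm' _ _).1 hlim.snd_nhds.snd_nhds
  refine ⟨Lp.memLp _, z.2.1, memSobolev_of_mem_closure hΩ hp hz, φ, hφ,
    l1.congr fun n => eLpNorm_congr_ae ?_, l2.congr fun n => eLpNorm_congr_ae ?_,
    l3.congr fun n => eLpNorm_congr_ae ?_⟩
  · exact (h1 n).mono fun x hx => by rw [Pi.sub_apply, hx]
  · exact (h2 n).mono fun x hx => by rw [Pi.sub_apply, hx]
  · exact (h3 n).mono fun x hx => by rw [Pi.sub_apply, hx]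

/-- Makes every test function of the weak formulation an admissible variation of the minimizer. -/
theorem toLp_mem_closure_of_isTrace (hΩ : IsSmoothBoundedDomain Ω) (hp : 1 < p)
    {v z : Euc N → ℝ} {G : Euc N → Euc N} (hv : MemSobolev p Ω v G) (hz : IsTrace p Ω v z) :
    (hv.memLp.toLp v, hv.memLp_grad.toLp G, hz.1.toLp z) ∈
      (smoothTriples p Ω).topologicalClosure := by
  obtain ⟨hzm, G', hG', φ, hφ, l1, l2, l3⟩ := hz
  have hGG := ae_eq_of_hasWeakGradient hΩ hp hv hG'
  have m1 := fun n => hΩ.memLp_volume (hφ n).continuous (ENNReal.ofReal p)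
  have m2 := fun n => hΩ.memLp_volume (continuous_gradient_of_contDiff (hφ n)) (ENNReal.ofReal p)
  have m3 := fun n => hΩ.memLp_surface (hφ n).continuous (ENNReal.ofReal p)
  refine mem_closure_iff_seq_limit.2 ⟨fun n => ((m1 n).toLp _, (m2 n).toLp _, (m3 n).toLp _),
    fun n => ⟨φ n, hφ n, (m1 n).coeFn_toLp, (m2 n).coeFn_toLp, (m3 n).coeFn_toLp⟩, ?_⟩
  refine Tendsto.prodMk_nhds ?_ (Tendsto.prodMk_nhds ?_ ?_)
  · exact (Lp.tendsto_Lp_iff_tendsto_eLpNorm'' _ m1 _ _).2 l1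
  · refine (Lp.tendsto_Lp_iff_tendsto_eLpNorm'' _ m2 _ _).2 (l2.congr fun n =>
      eLpNorm_congr_ae (hGG.mono fun x hx => ?_))
    rw [Pi.sub_apply, hx]
  · exact (Lp.tendsto_Lp_iff_tendsto_eLpNorm'' _ m3 _ _).2 l3

end Triples

/-! ### Existence of weak solutions. -/

section WeakSolution

variable {N : ℕ} {Ω : Set (Euc N)} {p : ℝ}

theorem abs_rpow_mul_eq_norm_rpow_mul_inner (p a b : ℝ) :
    |a| ^ (p - 2) * a * b = ‖a‖ ^ (p - 2) * inner ℝ a b := by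
  rw [Real.norm_eq_abs, mul_assoc]
  simp [mul_comm]

theorem integral_weakForm_eq (hp : 1 < p) {u v : Euc N → ℝ} {Gu Gv : Euc N → Euc N}
    (hu : MemSobolev p Ω u Gu) (hv : MemSobolev p Ω v Gv) :
    ∫ x in Ω, (‖Gu x‖ ^ (p - 2) * inner ℝ (Gu x) (Gv x) + |u x| ^ (p - 2) * u x * v x) =
      (∫ x in Ω, ‖u x‖ ^ (p - 2) * inner ℝ (u x) (v x)) +
        ∫ x in Ω, ‖Gu x‖ ^ (p - 2) * inner ℝ (Gu x) (Gv x) := by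
  simp only [abs_rpow_mul_eq_norm_rpow_mul_inner]
  rw [integral_add (integrable_norm_rpow_sub_two_mul_inner hp hu.memLp_grad hv.memLp_grad)
    (integrable_norm_rpow_sub_two_mul_inner hp hu.memLp hv.memLp), add_comm]

theorem exists_isWeakSolution (hΩ : IsSmoothBoundedDomain Ω) (hp : 1 < p) {f : Euc N → ℝ}
    (hf : MemLp f (ENNReal.ofReal (p / (p - 1))) (surfaceMeasure Ω)) :
    ∃ u, IsWeakSolution p Ω f u := by
  have hfact : Fact (1 ≤ ENNReal.ofReal p) := ⟨by simpa using hp.le⟩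
  have hq := Real.HolderConjugate.conjExponent hp
  have := hq.symm.ennrealOfReal
  have : Fact (1 ≤ ENNReal.ofReal p.conjExponent) := ⟨by simpa using hq.symm.lt.le⟩
  have hf' : MemLp f (ENNReal.ofReal p.conjExponent) (surfaceMeasure Ω) := hf
  -- The boundary load `w ↦ ∫ f w`, continuous on `L^p(∂Ω)` by Hölder.
  set ℓ := (ContinuousLinearMap.mul ℝ ℝ).lpPairing (surfaceMeasure Ω)
    (ENNReal.ofReal p.conjExponent) (ENNReal.ofReal p) (hf'.toLp f) with hℓ
  obtain ⟨C, hC, hbound⟩ := exists_norm_trace_rpow_le hΩ hp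
  obtain ⟨z, hz, hmin⟩ := exists_isMinOn_tripleEnergy hp
    (uniformlyConvexPow_lp (volume.restrict Ω) ℝ hp)
    (uniformlyConvexPow_lp (volume.restrict Ω) (Euc N) hp) ℓ hC
    (smoothTriples p Ω).isClosed_topologicalClosure hbound
  have hzS := memSobolev_of_mem_closure hΩ hp hz
  refine ⟨z.1, z.2.1, hzS, ⟨_, isTrace_of_mem_closure hΩ hp hz⟩, fun v Gv w hv hw => ?_⟩
  have key := pairing_eq_of_isMinOn_tripleEnergy hp ℓ hz
    (toLp_mem_closure_of_isTrace hΩ hp hv hw) hmin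
  rw [integral_weakForm_eq hp hzS hv]
  have e1 : ∫ x in Ω, ‖z.1 x‖ ^ (p - 2) * inner ℝ (z.1 x) (v x) =
      ∫ x in Ω, ‖z.1 x‖ ^ (p - 2) * inner ℝ (z.1 x) (hv.memLp.toLp v x) :=
    integral_congr_ae (hv.memLp.coeFn_toLp.mono fun x hx => by simp only [hx])
  have e2 : ∫ x in Ω, ‖z.2.1 x‖ ^ (p - 2) * inner ℝ (z.2.1 x) (Gv x) =
      ∫ x in Ω, ‖z.2.1 x‖ ^ (p - 2) * inner ℝ (z.2.1 x) (hv.memLp_grad.toLp Gv x) :=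
    integral_congr_ae (hv.memLp_grad.coeFn_toLp.mono fun x hx => by simp only [hx])
  rw [e1, e2, key, hℓ, ContinuousLinearMap.lpPairing_eq_integral]
  refine integral_congr_ae ?_
  filter_upwards [hf'.coeFn_toLp, hw.1.coeFn_toLp] with x h1 h2
  rw [h1, h2]
  rfl

end WeakSolution

/-! ### Comparing `L` with `J`, and the main theorem. -/

section Comparison

variable {N : ℕ} {Ω : Set (Euc N)} {p : ℝ}

theorem integral_norm_rpow_sub_two_mul_inner_sub {α : Type*} [MeasurableSpace α] {μ : Measure α}
    {F : Type*} [NormedAddCommGroup F] [InnerProductSpace ℝ F] (hp : 1 < p) {u v : α → F}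
    (hu : MemLp u (ENNReal.ofReal p) μ) (hv : MemLp v (ENNReal.ofReal p) μ) :
    ∫ x, ‖v x‖ ^ (p - 2) * inner ℝ (v x) (u x - v x) ∂μ =
      (∫ x, ‖v x‖ ^ (p - 2) * inner ℝ (v x) (u x) ∂μ) - ∫ x, ‖v x‖ ^ p ∂μ := by
  rw [← integral_sub (integrable_norm_rpow_sub_two_mul_inner hp hv hu)
    (hv.integrable_norm_rpow_ofReal hp)]
  refine integral_congr_ae (ae_of_all _ fun x => ?_)
  simp only [inner_sub_right, mul_sub, norm_rpow_sub_two_mul_inner_self hp]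

theorem MemSobolev.energy_eq (hp : 1 < p) {u Tu f : Euc N → ℝ} {Gu : Euc N → Euc N}
    (hu : MemSobolev p Ω u Gu)
    (hweak : ∫ x in Ω, (‖Gu x‖ ^ (p - 2) * inner ℝ (Gu x) (Gu x) + |u x| ^ (p - 2) * u x * u x) =
      ∫ x, f x * Tu x ∂(surfaceMeasure Ω)) :
    (∫ x in Ω, ‖u x‖ ^ p) + ∫ x in Ω, ‖Gu x‖ ^ p = ∫ x, f x * Tu x ∂(surfaceMeasure Ω) := by
  rw [← hweak, integral_weakForm_eq hp hu hu]
  simp only [norm_rpow_sub_two_mul_inner_self hp]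

theorem MemSobolev.tangent_le (hp : 1 < p) {u v : Euc N → ℝ} {Gu Gv : Euc N → Euc N}
    (hu : MemSobolev p Ω u Gu) (hv : MemSobolev p Ω v Gv) :
    p * ((∫ x in Ω, ‖v x‖ ^ (p - 2) * inner ℝ (v x) (u x)) +
        ∫ x in Ω, ‖Gv x‖ ^ (p - 2) * inner ℝ (Gv x) (Gu x)) ≤
      ((∫ x in Ω, ‖u x‖ ^ p) + ∫ x in Ω, ‖Gu x‖ ^ p) +
        (p - 1) * ((∫ x in Ω, ‖v x‖ ^ p) + ∫ x in Ω, ‖Gv x‖ ^ p) := by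
  have h1 := integral_norm_rpow_tangent_le hp hu.memLp hv.memLp
  have h2 := integral_norm_rpow_tangent_le hp hu.memLp_grad hv.memLp_grad
  rw [integral_norm_rpow_sub_two_mul_inner_sub hp hu.memLp hv.memLp] at h1
  rw [integral_norm_rpow_sub_two_mul_inner_sub hp hu.memLp_grad hv.memLp_grad] at h2
  linarith

theorem MemSobolev.ae_eq_of_tangent_eq (hp : 1 < p) {u v : Euc N → ℝ} {Gu Gv : Euc N → Euc N}
    (hu : MemSobolev p Ω u Gu) (hv : MemSobolev p Ω v Gv)
    (h : ((∫ x in Ω, ‖u x‖ ^ p) + ∫ x in Ω, ‖Gu x‖ ^ p) +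
        (p - 1) * ((∫ x in Ω, ‖v x‖ ^ p) + ∫ x in Ω, ‖Gv x‖ ^ p) ≤
      p * ((∫ x in Ω, ‖v x‖ ^ (p - 2) * inner ℝ (v x) (u x)) +
        ∫ x in Ω, ‖Gv x‖ ^ (p - 2) * inner ℝ (Gv x) (Gu x))) :
    u =ᵐ[volume.restrict Ω] v ∧ Gu =ᵐ[volume.restrict Ω] Gv := by
  have h1 := integral_norm_rpow_tangent_le hp hu.memLp hv.memLp
  have h2 := integral_norm_rpow_tangent_le hp hu.memLp_grad hv.memLp_grad
  have e1 := integral_norm_rpow_sub_two_mul_inner_sub hp hu.memLp hv.memLp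
  have e2 := integral_norm_rpow_sub_two_mul_inner_sub hp hu.memLp_grad hv.memLp_grad
  rw [e1] at h1
  rw [e2] at h2
  refine ⟨ae_eq_of_integral_norm_rpow_tangent_eq hp hu.memLp hv.memLp ?_,
    ae_eq_of_integral_norm_rpow_tangent_eq hp hu.memLp_grad hv.memLp_grad ?_⟩
  · rw [e1]
    linarith
  · rw [e2]
    linarith

theorem ae_eq_of_forall_integral_mul_smooth_eq {f g : Euc N → ℝ}
    (hf : Integrable f (surfaceMeasure Ω)) (hg : Integrable g (surfaceMeasure Ω))
    (h : ∀ φ : Euc N → ℝ, ContDiff ℝ ∞ φ →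
      ∫ x, f x * φ x ∂(surfaceMeasure Ω) = ∫ x, g x * φ x ∂(surfaceMeasure Ω)) :
    f =ᵐ[surfaceMeasure Ω] g := by
  have hloc : LocallyIntegrable (fun x => f x - g x) (surfaceMeasure Ω) :=
    (hf.sub hg).locallyIntegrable
  have key := ae_eq_zero_of_integral_contDiff_smul_eq_zero hloc fun φ hφ hc => by
    obtain ⟨C, hC⟩ := hφ.continuous.bounded_above_of_compact_support hc
    have hb : ∀ {k : Euc N → ℝ}, Integrable k (surfaceMeasure Ω) →
        Integrable (fun x => k x * φ x) (surfaceMeasure Ω) := fun hk =>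
      hk.mul_bdd (c := C) hφ.continuous.aestronglyMeasurable (ae_of_all _ hC)
    have e : ∀ x, φ x • (f x - g x) = f x * φ x - g x * φ x := fun x => by
      rw [smul_eq_mul]
      ring
    simp only [e]
    rw [integral_sub (hb hf) (hb hg), h φ hφ, sub_self]
  exact key.mono fun x hx => sub_eq_zero.1 hx

theorem integrable_of_memLp_conjExponent (hΩ : IsSmoothBoundedDomain Ω) (hp : 1 < p)
    {f : Euc N → ℝ} (hf : MemLp f (ENNReal.ofReal (p / (p - 1))) (surfaceMeasure Ω)) :
    Integrable f (surfaceMeasure Ω) := by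
  have := hΩ.isFiniteMeasure_surfaceMeasure
  refine hf.integrable ?_
  have : 1 ≤ p / (p - 1) := by
    rw [le_div_iff₀ (by linarith)]
    linarith
  simpa using this

theorem integrable_mul_of_memLp_conjExponent (hp : 1 < p) {f w : Euc N → ℝ}
    (hf : MemLp f (ENNReal.ofReal (p / (p - 1))) (surfaceMeasure Ω))
    (hw : MemLp w (ENNReal.ofReal p) (surfaceMeasure Ω)) :
    Integrable (fun x => f x * w x) (surfaceMeasure Ω) := by
  have := (Real.HolderConjugate.conjExponent hp).symm.ennrealOfReal
  have hf' : MemLp f (ENNReal.ofReal p.conjExponent) (surfaceMeasure Ω) := hf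
  exact hf'.integrable_mul hw

theorem isTrace_boundaryTrace {u : Euc N → ℝ} (h : ∃ w, IsTrace p Ω u w) :
    IsTrace p Ω u (boundaryTrace p Ω u) := by
  rw [boundaryTrace, dif_pos h]
  exact h.choose_spec

theorem isWeakSolution_neumannSolution (hΩ : IsSmoothBoundedDomain Ω) (hp : 1 < p)
    {f : Euc N → ℝ} (hf : MemLp f (ENNReal.ofReal (p / (p - 1))) (surfaceMeasure Ω)) :
    IsWeakSolution p Ω f (neumannSolution p Ω f) := by
  have h := exists_isWeakSolution hΩ hp hf
  rw [neumannSolution, dif_pos h]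
  exact h.choose_spec

theorem functionalL_le_functionalJ (hΩ : IsSmoothBoundedDomain Ω) (hp : 1 < p) {f g : Euc N → ℝ}
    (hf : MemLp f (ENNReal.ofReal (p / (p - 1))) (surfaceMeasure Ω))
    (hg : MemLp g (ENNReal.ofReal (p / (p - 1))) (surfaceMeasure Ω)) :
    p * functionalL p Ω (neumannSolution p Ω f) g ≤
        functionalJ p Ω f + (p - 1) * functionalJ p Ω g ∧
      (functionalJ p Ω f + (p - 1) * functionalJ p Ω g ≤
        p * functionalL p Ω (neumannSolution p Ω f) g → g =ᵐ[surfaceMeasure Ω] f) := by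
  obtain ⟨Gu, hu, htu, hweaku⟩ := isWeakSolution_neumannSolution hΩ hp hf
  obtain ⟨Gv, hv, htv, hweakv⟩ := isWeakSolution_neumannSolution hΩ hp hg
  set u := neumannSolution p Ω f
  set v := neumannSolution p Ω g
  have hTu := isTrace_boundaryTrace htu
  have hTv := isTrace_boundaryTrace htv
  -- Three tests: each equation with its own solution gives its energy, and the equation of `v` with
  -- `u` gives `L(g)`.
  have e1 : _ = functionalJ p Ω f := hu.energy_eq hp (hweaku u Gu _ hu hTu)
  have e2 : _ = functionalJ p Ω g := hv.energy_eq hp (hweakv v Gv _ hv hTv)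
  have e3 : _ = functionalL p Ω u g := hweakv u Gu _ hu hTu
  rw [integral_weakForm_eq hp hv hu] at e3
  refine ⟨?_, fun hle => ?_⟩
  · have h := hu.tangent_le hp hv
    rwa [e1, e2, e3] at h
  · rw [← e1, ← e2, ← e3] at hle
    obtain ⟨huv, hGuv⟩ := hu.ae_eq_of_tangent_eq hp hv hle
    -- Once `u = v` and the gradients agree, both equations have the same left side, so `f` and `g`
    -- have equal integrals against smooth functions.
    refine ae_eq_of_forall_integral_mul_smooth_eq (integrable_of_memLp_conjExponent hΩ hp hg)
      (integrable_of_memLp_conjExponent hΩ hp hf) fun φ hφ => ?_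
    have hS := memSobolev_of_contDiff hΩ p hφ
    have hT := isTrace_of_contDiff hΩ p hφ
    rw [← hweaku φ _ φ hS hT, ← hweakv φ _ φ hS hT]
    refine integral_congr_ae ?_
    filter_upwards [huv, hGuv] with x h1 h2
    rw [h1, h2]

theorem admitsExchange_surfaceMeasure (hN : 1 ≤ N) (hΩ : IsSmoothBoundedDomain Ω) :
    AdmitsExchange (surfaceMeasure Ω) := by
  have := hΩ.isFiniteMeasure_surfaceMeasure
  -- For `N = 1` the surface measure counts boundary points; for `N ≥ 2` it has no atoms.
  rcases eq_or_lt_of_le hN with h1 | h1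
  · refine admitsExchange_of_atoms (m := 1) one_ne_zero (S := frontier Ω) ?_ fun x hx => ?_
    · rw [surfaceMeasure, Measure.restrict_apply isClosed_frontier.measurableSet.compl]
      simp
    · rw [surfaceMeasure, Measure.restrict_apply (measurableSet_singleton x),
        Set.inter_eq_left.2 (Set.singleton_subset_iff.2 hx), show N - 1 = 0 by omega]
      simp
  · have : NullSingletonClass (surfaceMeasure Ω) := by
      refine ⟨fun x => Measure.restrict_le_self.absolutelyContinuous ?_⟩
      have hd : (0 : ℝ) < ((N - 1 : ℕ) : ℝ) := by
        exact_mod_cast Nat.sub_pos_of_lt h1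
      have := Measure.nullSingletonClass_hausdorff (Euc N) hd
      rw [Measure.euclideanHausdorffMeasure_def, Measure.smul_apply, measure_singleton, smul_zero]
    exact admitsExchange_of_nullSingletonClass _

end Comparison

theorem theorem1 {N : ℕ} (hN : 1 ≤ N) (Ω : Set (Euc N)) (hΩ : IsSmoothBoundedDomain Ω)
    (p : ℝ) (hp : 1 < p) (f₀ : Euc N → ℝ)
    (hf₀ : MemLp f₀ (ENNReal.ofReal (p / (p - 1))) (surfaceMeasure Ω))
    (fhat : Euc N → ℝ) (hfhat : fhat ∈ rearrangements Ω f₀)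
    (hmax : IsMaxOn (functionalJ p Ω) (rearrangements Ω f₀) fhat)
    (uhat : Euc N → ℝ) (huhat : uhat = neumannSolution p Ω fhat) :
    (IsMaxOn (functionalL p Ω uhat) (rearrangements Ω f₀) fhat ∧
      ∀ g ∈ rearrangements Ω f₀, IsMaxOn (functionalL p Ω uhat) (rearrangements Ω f₀) g →
        g =ᵐ[surfaceMeasure Ω] fhat) ∧
    ∃ (I : Set ℝ) (φ : ℝ → ℝ), I.OrdConnected ∧ MonotoneOn φ I ∧
      ∀ᵐ x ∂(surfaceMeasure Ω),
        boundaryTrace p Ω uhat x ∈ I ∧ fhat x = φ (boundaryTrace p Ω uhat x) := by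
  subst huhat
  have hfin := hΩ.isFiniteMeasure_surfaceMeasure
  have hLp : ∀ g ∈ rearrangements Ω f₀,
      MemLp g (ENNReal.ofReal (p / (p - 1))) (surfaceMeasure Ω) := fun g hg =>
    (ProbabilityTheory.IdentDistrib.memLp_iff hg).2 hf₀
  have hfL := hLp fhat hfhat
  have hLJ : functionalL p Ω (neumannSolution p Ω fhat) fhat = functionalJ p Ω fhat := rfl
  have hLmax : ∀ g ∈ rearrangements Ω f₀, functionalL p Ω (neumannSolution p Ω fhat) g ≤
      functionalL p Ω (neumannSolution p Ω fhat) fhat := fun g hg => by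
    have h1 := (functionalL_le_functionalJ hΩ hp hfL (hLp g hg)).1
    have h2 : functionalJ p Ω g ≤ functionalJ p Ω fhat := hmax hg
    rw [hLJ]
    -- `p L(g) ≤ J(fhat) + (p-1) J(g) ≤ p J(fhat)`.
    nlinarith
  have huniq : ∀ g ∈ rearrangements Ω f₀, functionalL p Ω (neumannSolution p Ω fhat) fhat ≤
      functionalL p Ω (neumannSolution p Ω fhat) g → g =ᵐ[surfaceMeasure Ω] fhat :=
    fun g hg hle => by
    refine (functionalL_le_functionalJ hΩ hp hfL (hLp g hg)).2 ?_
    have h2 : functionalJ p Ω g ≤ functionalJ p Ω fhat := hmax hg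
    rw [hLJ] at hle
    -- `L(g) ≥ J(fhat) ≥ J(g)` is exactly the equality case of the comparison.
    nlinarith
  refine ⟨⟨fun g hg => hLmax g hg, fun g hg hgmax => huniq g hg (hgmax hfhat)⟩, ?_⟩
  obtain ⟨Gu, hu, htu, hweaku⟩ := isWeakSolution_neumannSolution hΩ hp hfL
  have hT := (isTrace_boundaryTrace htu).1
  exact exists_monotoneOn_comp_of_unique_maximizer (admitsExchange_surfaceMeasure hN hΩ)
    hfL.1.aemeasurable hT.1.aemeasurable (integrable_of_memLp_conjExponent hΩ hp hfL)
    (fun g hg => integrable_mul_of_memLp_conjExponent hp (hLp g (hg.trans hfhat)) hT)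
    (fun g hg hle => huniq g (hg.trans hfhat) hle)
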